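/- For a real number $y$ let $\|y\|$ denote its distance to the nearest integer. Put $$c_1:=\frac{1}{\sqrt3\,e}\exp\Bigl(-\sum_{p\ge 5,\ p\text{ prime}}\frac{\log p}{p(p-1)}\Bigr)\quad(\approx 0.16948).$$ Let $a,t$ be positive integers with $t^2\ge 9a$. Then the equation $3x^3-3tx^2-3ax+at=0$ has a unique real solution $x$ with $x>t/2$; let $x$ be this solution. Define $$\tau_3:=\frac{4(3t^2+a)}{\sqrt\pi},\qquad \tau_4:=\frac{105\sqrt3\,e^2a^4}{2\sqrt\pi\,t(t^2+2a)(3t^2+a)},$$ $$c_6:=\frac{144(t^2+a)^3}{c_1^2e^2},\qquad c_7:=\frac{c_1^2e^2t^4(t^2+2a)^2}{9a^6(t^2+a)},$$ and assume that $c_7>e$. Then every positive integer $q\ge \dfrac{c_7}{2\tau_4}$ satisfies $$\|qx\|>\frac{(\log c_7)^{1/2}}{6\,\tau_3\,c_6^2\,(2\tau_4)^{\frac{\log c_6}{\log c_7}}}\cdot q^{-\frac{\log c_6}{\log c_7}}\cdot\bigl(\log(2\tau_4q)\bigr)^{-\frac{\log c_6}{\log c_7}-\frac12}.$$ The exponent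 $\frac{\log c_6}{\log c_7}$ is smaller than Liouville's exponent $2$ for cubic numbers if and only if $c_6<c_7^2$. -/

import Mathlib

namespace CubicApprox

noncomputable section

/-- The distance from a real number to the nearest integer. -/
def distInt (y : ℝ) : ℝ := |y - round y|

/-- The term attached to a prime `p ≥ 5` in the series that defines `c₁`. -/
def primeTerm (p : {p : ℕ // p.Prime ∧ 5 ≤ p}) : ℝ :=
  Real.log (p : ℕ) / (((p : ℕ) : ℝ) * (((p : ℕ) : ℝ) - 1))

/-- The series that defines `c₁` converges, so that its `tsum` is its actual sum. -/
theorem summable_primeTerm : Summable primeTerm := by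
  have h : Summable (fun n : ℕ => 4 * (1 / (n : ℝ) ^ (3 / 2 : ℝ))) :=
    (Real.summable_one_div_nat_rpow.mpr (by norm_num)).mul_left 4
  have h' : Summable (fun p : {p : ℕ // p.Prime ∧ 5 ≤ p} =>
      4 * (1 / ((p : ℕ) : ℝ) ^ (3 / 2 : ℝ))) := h.comp_injective Subtype.val_injective
  refine Summable.of_nonneg_of_le ?_ ?_ h'
  · rintro ⟨p, -, hp⟩
    have hp' : (5 : ℝ) ≤ (p : ℝ) := by exact_mod_cast hp
    have : 0 ≤ Real.log (p : ℝ) := Real.log_nonneg (by linarith)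
    have : 0 ≤ (p : ℝ) - 1 := by linarith
    unfold primeTerm
    positivity
  · rintro ⟨p, -, hp⟩
    have hp' : (5 : ℝ) ≤ (p : ℝ) := by exact_mod_cast hp
    have hp0 : (0 : ℝ) < (p : ℝ) := by linarith
    have hlog : Real.log (p : ℝ) ≤ (p : ℝ) ^ (1 / 2 : ℝ) / (1 / 2) :=
      Real.log_le_rpow_div hp0.le (by norm_num)
    have hmul : (p : ℝ) ^ (1 / 2 : ℝ) * (p : ℝ) ^ (3 / 2 : ℝ) = (p : ℝ) ^ 2 := by
      rw [← Real.rpow_add hp0, ← Real.rpow_natCast]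
      norm_num
    have h3 : 0 < (p : ℝ) ^ (3 / 2 : ℝ) := Real.rpow_pos_of_pos hp0 _
    unfold primeTerm
    rw [mul_one_div, div_le_div_iff₀ (mul_pos hp0 (by linarith)) h3]
    calc Real.log (p : ℝ) * (p : ℝ) ^ (3 / 2 : ℝ)
        ≤ (p : ℝ) ^ (1 / 2 : ℝ) / (1 / 2) * (p : ℝ) ^ (3 / 2 : ℝ) := by gcongr
      _ = 2 * ((p : ℝ) ^ (1 / 2 : ℝ) * (p : ℝ) ^ (3 / 2 : ℝ)) := by ring
      _ = 2 * (p : ℝ) ^ 2 := by rw [hmul]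
      _ ≤ 4 * ((p : ℝ) * ((p : ℝ) - 1)) := by nlinarith

/-- The absolute constant `c₁`. -/
def c1 : ℝ := 1 / (√3 * Real.exp 1) * Real.exp (-∑' p, primeTerm p)

/-- The constant `τ₃`. -/
def tau3 (a t : ℝ) : ℝ := 4 * (3 * t ^ 2 + a) / √Real.pi

/-- The constant `τ₄`. -/
def tau4 (a t : ℝ) : ℝ :=
  105 * √3 * Real.exp 1 ^ 2 * a ^ 4
    / (2 * √Real.pi * t * (t ^ 2 + 2 * a) * (3 * t ^ 2 + a))

/-- The constant `c₆`. -/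
def c6 (a t : ℝ) : ℝ := 144 * (t ^ 2 + a) ^ 3 / (c1 ^ 2 * Real.exp 1 ^ 2)

/-- The constant `c₇`. -/
def c7 (a t : ℝ) : ℝ :=
  c1 ^ 2 * Real.exp 1 ^ 2 * t ^ 4 * (t ^ 2 + 2 * a) ^ 2 / (9 * a ^ 6 * (t ^ 2 + a))

end

end CubicApprox

namespace CubicApprox

open Finset

open scoped ComplexConjugate

/-! This is Thue's hypergeometric method. Put p = t√(t⁴+3at²+3a²), r = a√a, U = p + ri and V = p -
ri, so that |U|² = (t²+a)³, and let φ = arg U. By the triple-angle formula tan(φ/3) satisfies a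
cubic which a Möbius substitution turns into the given one; this is the closed form `root`.

The diagonal Padé forms for z^ν with ν = 1/3, evaluated at (U, V), point nearly in the direction φ/3
modulo π. In odd degree 2n+1, once denominators are cleared, such a form equals e·p + f·r·i with
integers e, f. Hence tan(φ/3) ≈ fr/(ep), and the square roots cancel in x ≈ P/Q with P = t(t²+a)e
and Q = t²e + af.

`sum_besselCoeff` controls the size of Q, `abs_padeRemainder_le` the error Qx - P,
`exists_int_eq_padeCoeff` the denominators, and `padeForm_det_add_two_ne_zero` shows that
consecutive fractions P/Q differ. `distInt_gt_of_approx` converts such a sequence into a lower bound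
for ‖qx‖.

Only powers of 3 are needed to clear denominators, which gives the growth factor 27·16 = 432 for Q.
The constant c₁ therefore enters only through c₁²e² ≤ 1/3, that is, through the sign of the prime
series. -/

/-! ### Padé forms: recurrence and determinants -/

/-- The coefficients of the hypergeometric series `₀F₁(1 - ν)`. -/
noncomputable def besselCoeff (ν : ℝ) (i : ℕ) : ℝ :=
  ∏ s ∈ range i, (((s : ℝ) + 1) * ((s : ℝ) + 1 - ν))⁻¹

theorem besselCoeff_succ {ν : ℝ} (h1 : ν < 1) (i : ℕ) :
    ((i : ℝ) + 1) * ((i : ℝ) + 1 - ν) * besselCoeff ν (i + 1) = besselCoeff ν i := by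
  have hi : (0 : ℝ) ≤ i := i.cast_nonneg
  have : ((i : ℝ) + 1) * ((i : ℝ) + 1 - ν) ≠ 0 := by
    have : (0 : ℝ) < (i : ℝ) + 1 - ν := by linarith
    positivity
  unfold besselCoeff
  rw [prod_range_succ, mul_comm, mul_assoc, inv_mul_cancel₀ this, mul_one]

theorem besselCoeff_pos {ν : ℝ} (h1 : ν < 1) (i : ℕ) : 0 < besselCoeff ν i := by
  refine prod_pos fun s _ => ?_
  have hi : (0 : ℝ) ≤ s := s.cast_nonneg
  have : (0 : ℝ) < (s : ℝ) + 1 - ν := by linarith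
  positivity

section Module

variable {M : Type*} [AddCommGroup M] [Module ℝ M]

/-- The coefficient recursion trades a factor i(i - ν) for a shift of i, and the term i = 0
vanishes. Identities between such sums thereby become polynomial identities in i, j on a line i + j
= const. The module M covers both the complex forms and the real trigonometric sums. -/
theorem sum_shift_left {ν : ℝ} (h1 : ν < 1) (m : ℕ) (e : ℕ → ℕ → M) :
    ∑ ij ∈ antidiagonal (m + 1), ((ij.1 : ℝ) * ((ij.1 : ℝ) - ν) *
      (besselCoeff ν ij.1 * besselCoeff (-ν) ij.2)) • e ij.1 ij.2 =
    ∑ ij ∈ antidiagonal m, (besselCoeff ν ij.1 * besselCoeff (-ν) ij.2) •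
      e (ij.1 + 1) ij.2 := by
  rw [Nat.sum_antidiagonal_succ]
  simp only [CharP.cast_eq_zero, zero_mul, zero_smul, zero_add, Nat.cast_add, Nat.cast_one]
  refine sum_congr rfl fun ij _ => ?_
  rw [← besselCoeff_succ h1 ij.1]
  congr 1
  ring

theorem sum_shift_right {ν : ℝ} (h0 : -1 < ν) (m : ℕ) (e : ℕ → ℕ → M) :
    ∑ ij ∈ antidiagonal (m + 1), ((ij.2 : ℝ) * ((ij.2 : ℝ) + ν) *
      (besselCoeff ν ij.1 * besselCoeff (-ν) ij.2)) • e ij.1 ij.2 =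
    ∑ ij ∈ antidiagonal m, (besselCoeff ν ij.1 * besselCoeff (-ν) ij.2) •
      e ij.1 (ij.2 + 1) := by
  rw [Nat.sum_antidiagonal_succ']
  simp only [CharP.cast_eq_zero, zero_mul, zero_smul, zero_add, Nat.cast_add, Nat.cast_one]
  refine sum_congr rfl fun ij _ => ?_
  rw [← besselCoeff_succ (ν := -ν) (by linarith) ij.2]
  congr 1
  ring

end Module

/-- The Jacobi-type forms which yield the diagonal Padé approximants of `z ↦ z ^ ν`. -/
noncomputable def padeForm (ν : ℝ) (m : ℕ) (x y : ℂ) : ℂ :=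
  ∑ ij ∈ antidiagonal m, (besselCoeff ν ij.1 * besselCoeff (-ν) ij.2) • (x ^ ij.1 * y ^ ij.2)

theorem padeForm_zero (ν : ℝ) (x y : ℂ) : padeForm ν 0 x y = 1 := by
  simp [padeForm, besselCoeff]

theorem padeForm_one (ν : ℝ) (x y : ℂ) :
    padeForm ν 1 x y = ((1 + ν)⁻¹ : ℝ) * y + ((1 - ν)⁻¹ : ℝ) * x := by
  simp [padeForm, besselCoeff, Nat.antidiagonal_succ]

/-- The shifts rewrite every product on the right as a sum over i + j = m + 2 with the same
coefficients; what remains is a polynomial identity in i and j. -/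
theorem padeForm_recurrence {ν : ℝ} (h0 : -1 < ν) (h1 : ν < 1) (m : ℕ) (x y : ℂ) :
    (((m : ℝ) + 2) * ((m : ℝ) + 1) * (((m : ℝ) + 2) ^ 2 - ν ^ 2)) • padeForm ν (m + 2) x y =
      ((2 * (m : ℝ) + 3) * ((m : ℝ) + 1)) • ((x + y) * padeForm ν (m + 1) x y)
        - (x - y) ^ 2 * padeForm ν m x y := by
  let e : ℕ → ℕ → ℂ := fun i j => x ^ i * y ^ j
  have hx : x * padeForm ν (m + 1) x y = ∑ ij ∈ antidiagonal (m + 2),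
      ((ij.1 : ℝ) * ((ij.1 : ℝ) - ν) * (besselCoeff ν ij.1 * besselCoeff (-ν) ij.2)) •
        e ij.1 ij.2 := by
    rw [sum_shift_left h1, padeForm, mul_sum]
    refine sum_congr rfl fun ij _ => ?_
    rw [mul_smul_comm]; congr 1; simp only [e]; ring
  have hy : y * padeForm ν (m + 1) x y = ∑ ij ∈ antidiagonal (m + 2),
      ((ij.2 : ℝ) * ((ij.2 : ℝ) + ν) * (besselCoeff ν ij.1 * besselCoeff (-ν) ij.2)) •
        e ij.1 ij.2 := by
    rw [sum_shift_right h0, padeForm, mul_sum]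
    refine sum_congr rfl fun ij _ => ?_
    rw [mul_smul_comm]; congr 1; simp only [e]; ring
  have hxx : x ^ 2 * padeForm ν m x y = ∑ ij ∈ antidiagonal (m + 2),
      ((ij.1 : ℝ) * ((ij.1 : ℝ) - ν) * (besselCoeff ν ij.1 * besselCoeff (-ν) ij.2)) •
        ((((ij.1 : ℝ) - 1) * ((ij.1 : ℝ) - 1 - ν)) • e ij.1 ij.2) := by
    rw [sum_shift_left h1 (m + 1)
      (fun i j => ((((i : ℝ) - 1) * ((i : ℝ) - 1 - ν)) • e i j))]
    have := sum_shift_left h1 m (fun i j => e (i + 1) j)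
    rw [padeForm, mul_sum]
    refine Eq.trans ?_ (this.symm.trans ?_)
    · refine sum_congr rfl fun ij _ => ?_
      rw [mul_smul_comm]; congr 1; simp only [e]; ring
    · refine sum_congr rfl fun ij _ => ?_
      rw [smul_smul]; congr 1; push_cast; ring
  have hyy : y ^ 2 * padeForm ν m x y = ∑ ij ∈ antidiagonal (m + 2),
      ((ij.2 : ℝ) * ((ij.2 : ℝ) + ν) * (besselCoeff ν ij.1 * besselCoeff (-ν) ij.2)) •
        ((((ij.2 : ℝ) - 1) * ((ij.2 : ℝ) - 1 + ν)) • e ij.1 ij.2) := by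
    rw [sum_shift_right h0 (m + 1)
      (fun i j => ((((j : ℝ) - 1) * ((j : ℝ) - 1 + ν)) • e i j))]
    have := sum_shift_right h0 m (fun i j => e i (j + 1))
    rw [padeForm, mul_sum]
    refine Eq.trans ?_ (this.symm.trans ?_)
    · refine sum_congr rfl fun ij _ => ?_
      rw [mul_smul_comm]; congr 1; simp only [e]; ring
    · refine sum_congr rfl fun ij _ => ?_
      rw [smul_smul]; congr 1; push_cast; ring
  have hxy : x * y * padeForm ν m x y = ∑ ij ∈ antidiagonal (m + 2),
      ((ij.1 : ℝ) * ((ij.1 : ℝ) - ν) * (besselCoeff ν ij.1 * besselCoeff (-ν) ij.2)) •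
        (((ij.2 : ℝ) * ((ij.2 : ℝ) + ν)) • e ij.1 ij.2) := by
    rw [sum_shift_left h1 (m + 1)
      (fun i j => (((j : ℝ) * ((j : ℝ) + ν)) • e i j))]
    have := sum_shift_right h0 m (fun i j => e (i + 1) j)
    rw [padeForm, mul_sum]
    refine Eq.trans ?_ (this.symm.trans ?_)
    · refine sum_congr rfl fun ij _ => ?_
      rw [mul_smul_comm]; congr 1; simp only [e]; ring
    · refine sum_congr rfl fun ij _ => ?_
      rw [smul_smul]; congr 1; ring
  have hexp : (x - y) ^ 2 * padeForm ν m x y = x ^ 2 * padeForm ν m x y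
      + y ^ 2 * padeForm ν m x y - (2 : ℝ) • (x * y * padeForm ν m x y) := by
    rw [Complex.real_smul]; push_cast; ring
  rw [hexp, add_mul x y, hx, hy, hxx, hyy, hxy, padeForm, smul_add, smul_sum, smul_sum, smul_sum,
    smul_sum, ← sum_add_distrib, ← sum_add_distrib, ← sum_sub_distrib, ← sum_sub_distrib]
  refine sum_congr rfl fun ij hij => ?_
  have hm : (m : ℝ) = ij.1 + ij.2 - 2 := by
    have := mem_antidiagonal.1 hij
    have : (ij.1 : ℝ) + ij.2 = m + 2 := by exact_mod_cast this
    linarith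
  simp only [smul_smul, ← add_smul, ← sub_smul]
  congr 1
  rw [hm]
  ring

/-- This is the Casoratian of the recurrence: in passing from m to m + 1 the (x + y) terms cancel,
and up to a scalar it is multiplied by (x - y)². -/
theorem padeForm_det_succ_ne_zero {ν : ℝ} (h0 : 0 < ν) (h1 : ν < 1) {x y : ℂ} (hxy : x ≠ y)
    (m : ℕ) : padeForm ν (m + 1) x y * padeForm ν m y x
      - padeForm ν (m + 1) y x * padeForm ν m x y ≠ 0 := by
  induction m with
  | zero =>
    rw [padeForm_zero, padeForm_zero, padeForm_one, padeForm_one]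
    have h : (((1 + ν)⁻¹ : ℝ) * y + ((1 - ν)⁻¹ : ℝ) * x) * 1
      - (((1 + ν)⁻¹ : ℝ) * x + ((1 - ν)⁻¹ : ℝ) * y) * 1
      = (((1 - ν)⁻¹ - (1 + ν)⁻¹ : ℝ) : ℂ) * (x - y) := by push_cast; ring
    rw [h]
    refine mul_ne_zero ?_ (sub_ne_zero.2 hxy)
    have : (1 + ν)⁻¹ < (1 - ν)⁻¹ := by
      apply inv_strictAnti₀ <;> linarith
    exact_mod_cast (sub_pos.2 this).ne'
  | succ m ih =>
    have hr := padeForm_recurrence (by linarith) h1 m x y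
    have hr' := padeForm_recurrence (by linarith) h1 m y x
    rw [Complex.real_smul, Complex.real_smul] at hr hr'
    intro h
    refine mul_ne_zero (pow_ne_zero 2 (sub_ne_zero.2 hxy)) ih ?_
    linear_combination
      (((((m : ℝ) + 2) * ((m : ℝ) + 1) * (((m : ℝ) + 2) ^ 2 - ν ^ 2) : ℝ)) : ℂ) * h
      - padeForm ν (m + 1) y x * hr + padeForm ν (m + 1) x y * hr'

/-- Here the (x - y)² terms cancel instead, leaving (x + y) times the previous determinant. The gap
of two is needed because only odd degrees are used. -/
theorem padeForm_det_add_two_ne_zero {ν : ℝ} (h0 : 0 < ν) (h1 : ν < 1) {x y : ℂ} (hxy : x ≠ y)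
    (hxy' : x + y ≠ 0) (m : ℕ) : padeForm ν (m + 2) x y * padeForm ν m y x
      - padeForm ν (m + 2) y x * padeForm ν m x y ≠ 0 := by
  have hr := padeForm_recurrence (by linarith) h1 m x y
  have hr' := padeForm_recurrence (by linarith) h1 m y x
  rw [Complex.real_smul, Complex.real_smul] at hr hr'
  intro h
  have hc : (((2 * (m : ℝ) + 3) * ((m : ℝ) + 1) : ℝ) : ℂ) ≠ 0 := by
    have : (2 * (m : ℝ) + 3) * ((m : ℝ) + 1) ≠ 0 := by positivity
    exact_mod_cast this
  refine mul_ne_zero (mul_ne_zero hc hxy') (padeForm_det_succ_ne_zero h0 h1 hxy m) ?_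
  linear_combination
      (((((m : ℝ) + 2) * ((m : ℝ) + 1) * (((m : ℝ) + 2) ^ 2 - ν ^ 2) : ℝ)) : ℂ) * h
      - padeForm ν m y x * hr + padeForm ν m x y * hr'

/-! ### Size of the coefficients -/

/-- The product `∏ (s² - ν²)` over `1 ≤ s ≤ m`. -/
noncomputable def pochProd (ν : ℝ) (m : ℕ) : ℝ :=
  ∏ s ∈ range m, (((s : ℝ) + 1) ^ 2 - ν ^ 2)

/-- At x = y = 1 the last term of the recurrence drops out, and the two-term recurrence of the
central binomial coefficients remains. -/
theorem sum_besselCoeff {ν : ℝ} (h0 : -1 < ν) (h1 : ν < 1) (m : ℕ) :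
    pochProd ν m * ∑ ij ∈ antidiagonal m, besselCoeff ν ij.1 * besselCoeff (-ν) ij.2 =
      m.centralBinom := by
  have hsum (m : ℕ) : padeForm ν m 1 1 =
      ((∑ ij ∈ antidiagonal m, besselCoeff ν ij.1 * besselCoeff (-ν) ij.2 : ℝ) : ℂ) := by
    simp [padeForm]
  induction m with
  | zero => simp [pochProd, besselCoeff]
  | succ m ih =>
    have hm0 : (0 : ℝ) < (m : ℝ) + 1 := by positivity
    have key : ((m : ℝ) + 1) * (((m : ℝ) + 1) ^ 2 - ν ^ 2) *
        ∑ ij ∈ antidiagonal (m + 1), besselCoeff ν ij.1 * besselCoeff (-ν) ij.2 =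
        2 * (2 * (m : ℝ) + 1) *
        ∑ ij ∈ antidiagonal m, besselCoeff ν ij.1 * besselCoeff (-ν) ij.2 := by
      -- The recurrence first produces degree 2, so degree 1 is computed by hand.
      rcases m with _ | k
      · have h2 : 1 - ν ≠ 0 := by linarith
        have h3 : 1 + ν ≠ 0 := by linarith
        simp [besselCoeff, Nat.antidiagonal_succ]
        field_simp
        ring
      · have hr := padeForm_recurrence h0 h1 k 1 1
        rw [hsum, hsum, hsum, Complex.real_smul, Complex.real_smul] at hr
        have hr2 : (((k : ℝ) + 2) * ((k : ℝ) + 1) * (((k : ℝ) + 2) ^ 2 - ν ^ 2)) *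
            (∑ ij ∈ antidiagonal (k + 2), besselCoeff ν ij.1 * besselCoeff (-ν) ij.2) =
            ((2 * (k : ℝ) + 3) * ((k : ℝ) + 1)) * ((1 + 1) *
            (∑ ij ∈ antidiagonal (k + 1), besselCoeff ν ij.1 * besselCoeff (-ν) ij.2))
            - (1 - 1) ^ 2 *
            (∑ ij ∈ antidiagonal k, besselCoeff ν ij.1 * besselCoeff (-ν) ij.2) := by
          exact_mod_cast hr
        have hk : ((k : ℝ) + 1) ≠ 0 := by positivity
        apply mul_left_cancel₀ hk
        push_cast
        linear_combination hr2
    have hcb : ((m : ℝ) + 1) * ((m + 1).centralBinom : ℝ) =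
        2 * (2 * (m : ℝ) + 1) * (m.centralBinom : ℝ) := by
      exact_mod_cast Nat.succ_mul_centralBinom_succ m
    apply mul_left_cancel₀ hm0.ne'
    rw [hcb, ← ih, pochProd, prod_range_succ, ← pochProd]
    linear_combination pochProd ν m * key

theorem centralBinom_sq_le (m : ℕ) : (m.centralBinom : ℝ) ^ 2 * (2 * m + 1) ≤ 16 ^ m := by
  induction m with
  | zero => simp
  | succ m ih =>
    have hcb : ((m : ℝ) + 1) * ((m + 1).centralBinom : ℝ) =
        2 * (2 * (m : ℝ) + 1) * (m.centralBinom : ℝ) := by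
      exact_mod_cast Nat.succ_mul_centralBinom_succ m
    have hm0 : (0 : ℝ) < ((m : ℝ) + 1) ^ 2 := by positivity
    refine le_of_mul_le_mul_left ?_ hm0
    have hm : (0 : ℝ) ≤ m := m.cast_nonneg
    calc ((m : ℝ) + 1) ^ 2 * (((m + 1).centralBinom : ℝ) ^ 2 * (2 * ((m + 1 : ℕ) : ℝ) + 1))
        = (((m : ℝ) + 1) * ((m + 1).centralBinom : ℝ)) ^ 2 * (2 * m + 3) := by push_cast; ring
      _ = 4 * (2 * m + 1) * (2 * m + 3) * ((m.centralBinom : ℝ) ^ 2 * (2 * m + 1)) := by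
        rw [hcb]; ring
      _ ≤ 4 * (2 * m + 1) * (2 * m + 3) * 16 ^ m := by gcongr
      _ ≤ (16 * ((m : ℝ) + 1) ^ 2) * 16 ^ m :=
        mul_le_mul_of_nonneg_right (by nlinarith) (by positivity)
      _ = ((m : ℝ) + 1) ^ 2 * 16 ^ (m + 1) := by ring

/-! ### The remainder on the unit circle -/

/-- The remainder function of the Padé approximation to `z ↦ z ^ ν` on the unit circle. -/
noncomputable def padeRemainder (ν : ℝ) (m : ℕ) (φ : ℝ) : ℝ :=
  ∑ ij ∈ antidiagonal m, (besselCoeff ν ij.1 * besselCoeff (-ν) ij.2) •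
    Real.sin (((ij.1 : ℝ) - ij.2 - ν) * φ)

/-- Since (i + j)(i - j - ν) = i(i - ν) - j(j + ν), differentiation produces the two shifts, and the
difference of the shifted cosines is a product containing sin φ. -/
theorem hasDerivAt_padeRemainder {ν : ℝ} (h0 : -1 < ν) (h1 : ν < 1) (m : ℕ) (φ : ℝ) :
    HasDerivAt (padeRemainder ν (m + 1))
      (-(2 / ((m : ℝ) + 1)) * Real.sin φ * padeRemainder ν m φ) φ := by
  have hd : HasDerivAt (padeRemainder ν (m + 1))
      (∑ ij ∈ antidiagonal (m + 1), (besselCoeff ν ij.1 * besselCoeff (-ν) ij.2) •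
        (Real.cos (((ij.1 : ℝ) - ij.2 - ν) * φ) * ((ij.1 : ℝ) - ij.2 - ν))) φ := by
    unfold padeRemainder
    refine HasDerivAt.fun_sum fun ij _ => ?_
    have h : HasDerivAt (fun φ : ℝ => ((ij.1 : ℝ) - ij.2 - ν) * φ) ((ij.1 : ℝ) - ij.2 - ν) φ := by
      simpa using (hasDerivAt_id φ).const_mul ((ij.1 : ℝ) - ij.2 - ν)
    exact h.sin.const_smul (besselCoeff ν ij.1 * besselCoeff (-ν) ij.2)
  convert hd using 1
  have hm : (m : ℝ) + 1 ≠ 0 := by positivity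
  apply mul_left_cancel₀ hm
  let e : ℕ → ℕ → ℝ := fun i j => Real.cos (((i : ℝ) - j - ν) * φ)
  have hl := sum_shift_left h1 m e
  have hr := sum_shift_right h0 m e
  have hR : ((m : ℝ) + 1) * ∑ ij ∈ antidiagonal (m + 1),
      (besselCoeff ν ij.1 * besselCoeff (-ν) ij.2) •
        (Real.cos (((ij.1 : ℝ) - ij.2 - ν) * φ) * ((ij.1 : ℝ) - ij.2 - ν)) =
      ∑ ij ∈ antidiagonal (m + 1), ((ij.1 : ℝ) * ((ij.1 : ℝ) - ν) *
        (besselCoeff ν ij.1 * besselCoeff (-ν) ij.2)) • e ij.1 ij.2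
      - ∑ ij ∈ antidiagonal (m + 1), ((ij.2 : ℝ) * ((ij.2 : ℝ) + ν) *
        (besselCoeff ν ij.1 * besselCoeff (-ν) ij.2)) • e ij.1 ij.2 := by
    rw [mul_sum, ← sum_sub_distrib]
    refine sum_congr rfl fun ij hij => ?_
    have hm : (m : ℝ) = ij.1 + ij.2 - 1 := by
      have := mem_antidiagonal.1 hij
      have : (ij.1 : ℝ) + ij.2 = m + 1 := by exact_mod_cast this
      linarith
    simp only [smul_eq_mul, e, hm]
    ring
  rw [hR, hl, hr, ← sum_sub_distrib]
  have : ((m : ℝ) + 1) * (-(2 / ((m : ℝ) + 1)) * Real.sin φ * padeRemainder ν m φ) =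
      -2 * Real.sin φ * padeRemainder ν m φ := by
    field_simp
  rw [this, padeRemainder, mul_sum]
  refine sum_congr rfl fun ij _ => ?_
  have h3 : e (ij.1 + 1) ij.2 = Real.cos (((ij.1 : ℝ) - ij.2 - ν) * φ + φ) := by
    simp only [e]; congr 1; push_cast; ring
  have h4 : e ij.1 (ij.2 + 1) = Real.cos (((ij.1 : ℝ) - ij.2 - ν) * φ - φ) := by
    simp only [e]; congr 1; push_cast; ring
  rw [h3, h4, Real.cos_add, Real.cos_sub]
  simp only [smul_eq_mul]
  ring

theorem padeRemainder_zero_right (ν : ℝ) (m : ℕ) : padeRemainder ν m 0 = 0 := by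
  simp [padeRemainder]

/-- The remainder vanishes at 0 and its derivative is known from the previous degree, so the bound
is integrated inductively; sin ≥ 0 on [0, π]. -/
theorem abs_padeRemainder_le {ν : ℝ} (h0 : 0 < ν) (h1 : ν < 1) (m : ℕ) {φ : ℝ}
    (hφ0 : 0 ≤ φ) (hφ : φ ≤ Real.pi) :
    |padeRemainder ν m φ| ≤
      ν * 2 ^ m / (m.factorial : ℝ) ^ 2 * (φ * (1 - Real.cos φ) ^ m) := by
  induction m generalizing φ with
  | zero =>
    have : padeRemainder ν 0 φ = Real.sin (-ν * φ) := by
      simp [padeRemainder, besselCoeff]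
    rw [this]
    refine Real.abs_sin_le_abs.trans ?_
    rw [abs_mul, abs_neg, abs_of_pos h0, abs_of_nonneg hφ0]
    simp
  | succ m ih =>
    set C : ℝ := ν * 2 ^ (m + 1) / ((m + 1).factorial : ℝ) ^ 2 with hC
    have hB (x : ℝ) : HasDerivAt (fun φ : ℝ => C * (φ * (1 - Real.cos φ) ^ (m + 1)))
        (C * (1 * (1 - Real.cos x) ^ (m + 1) +
          x * (((m + 1 : ℕ) : ℝ) * (1 - Real.cos x) ^ m * Real.sin x))) x := by
      refine HasDerivAt.const_mul _ ((hasDerivAt_id x).mul ?_)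
      have h : HasDerivAt (fun φ : ℝ => 1 - Real.cos φ) (Real.sin x) x := by
        simpa using (Real.hasDerivAt_cos x).const_sub 1
      simpa using h.fun_pow (m + 1)
    have key := image_norm_le_of_norm_deriv_right_le_deriv_boundary
      (f := padeRemainder ν (m + 1)) (a := 0) (b := Real.pi)
      (f' := fun φ => -(2 / ((m : ℝ) + 1)) * Real.sin φ * padeRemainder ν m φ)
      (fun x _ => (hasDerivAt_padeRemainder (by linarith) h1 m x).continuousAt.continuousWithinAt)
      (fun x _ => (hasDerivAt_padeRemainder (by linarith) h1 m x).hasDerivWithinAt)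
      (by rw [padeRemainder_zero_right]; simp) hB ?_ ⟨hφ0, hφ⟩
    · exact key
    · intro x hx
      have hs : 0 ≤ Real.sin x := Real.sin_nonneg_of_nonneg_of_le_pi hx.1 hx.2.le
      have hc : 0 ≤ 1 - Real.cos x := by linarith [Real.cos_le_one x]
      have hCC : 2 / ((m : ℝ) + 1) * (ν * 2 ^ m / (m.factorial : ℝ) ^ 2) =
          C * ((m + 1 : ℕ) : ℝ) := by
        rw [hC, Nat.factorial_succ]
        have : (m.factorial : ℝ) ≠ 0 := by positivity
        push_cast
        field_simp
        ring
      have hC0 : 0 ≤ C := by positivity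
      rw [Real.norm_eq_abs, abs_mul, abs_mul, abs_neg, abs_of_nonneg hs,
        abs_of_nonneg (by positivity)]
      calc 2 / ((m : ℝ) + 1) * Real.sin x * |padeRemainder ν m x|
          ≤ 2 / ((m : ℝ) + 1) * Real.sin x *
            (ν * 2 ^ m / (m.factorial : ℝ) ^ 2 * (x * (1 - Real.cos x) ^ m)) := by
            gcongr
            exact ih hx.1 hx.2.le
        _ = C * (x * (((m + 1 : ℕ) : ℝ) * (1 - Real.cos x) ^ m * Real.sin x)) := by
            linear_combination (Real.sin x * (x * (1 - Real.cos x) ^ m)) * hCC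
        -- The derivative of the bound has a second, nonnegative summand, coming from the factor φ;
        -- it is discarded.
        _ ≤ _ := by
            have : 0 ≤ (1 - Real.cos x) ^ (m + 1) := by positivity
            gcongr
            linarith

theorem padeRemainder_eq_im (ν : ℝ) (m : ℕ) (φ : ℝ) :
    padeRemainder ν m φ = (padeForm ν m (Complex.exp (φ * Complex.I))
      (Complex.exp (-(φ * Complex.I))) * Complex.exp (-(ν * φ * Complex.I))).im := by
  rw [padeForm, sum_mul, Complex.im_sum, padeRemainder]
  refine sum_congr rfl fun ij _ => ?_
  rw [smul_mul_assoc, Complex.smul_im, ← Complex.exp_nat_mul, ← Complex.exp_nat_mul,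
    ← Complex.exp_add, ← Complex.exp_add]
  have : (ij.1 : ℂ) * (φ * Complex.I) + ij.2 * -(φ * Complex.I) + -(ν * φ * Complex.I) =
    ((((ij.1 : ℝ) - ij.2 - ν) * φ : ℝ) : ℂ) * Complex.I := by
    push_cast; ring
  rw [this, Complex.exp_ofReal_mul_I_im]

theorem pochProd_pos {ν : ℝ} (h0 : -1 < ν) (h1 : ν < 1) (m : ℕ) : 0 < pochProd ν m := by
  refine prod_pos fun s _ => ?_
  have : (0 : ℝ) ≤ s := s.cast_nonneg
  nlinarith

theorem pochProd_le {ν : ℝ} (h0 : -1 < ν) (h1 : ν < 1) (m : ℕ) :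
    pochProd ν m ≤ (m.factorial : ℝ) ^ 2 := by
  rw [← prod_range_add_one_eq_factorial, Nat.cast_prod, ← prod_pow]
  refine prod_le_prod (fun s _ => ?_) (fun s _ => ?_)
  · have : (0 : ℝ) ≤ s := s.cast_nonneg
    nlinarith
  · push_cast
    nlinarith [sq_nonneg ν]

theorem pochProd_mul_abs_padeRemainder_le {ν : ℝ} (h0 : 0 < ν) (h1 : ν < 1) (m : ℕ) {φ : ℝ}
    (hφ0 : 0 ≤ φ) (hφ : φ ≤ Real.pi) :
    pochProd ν m * |padeRemainder ν m φ| ≤ ν * φ * (2 * (1 - Real.cos φ)) ^ m := by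
  have hc : 0 ≤ 1 - Real.cos φ := by linarith [Real.cos_le_one φ]
  have hf : (m.factorial : ℝ) ≠ 0 := by positivity
  calc pochProd ν m * |padeRemainder ν m φ|
      ≤ (m.factorial : ℝ) ^ 2 *
        (ν * 2 ^ m / (m.factorial : ℝ) ^ 2 * (φ * (1 - Real.cos φ) ^ m)) := by
        gcongr
        · exact pochProd_le (by linarith) h1 m
        · exact abs_padeRemainder_le h0 h1 m hφ0 hφ
    _ = ν * φ * (2 * (1 - Real.cos φ)) ^ m := by
        rw [mul_pow]
        field_simp

/-! ### Integrality -/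

/-- Modulo the prime-to-3 part of k!, 3 has an inverse u, and the product becomes 3^k times a
product of k consecutive integers starting at uc. -/
theorem factorial_dvd_three_pow_mul_prod (k c : ℕ) :
    k.factorial ∣ 3 ^ padicValNat 3 k.factorial * ∏ s ∈ range k, (3 * s + c) := by
  have : Fact (Nat.Prime 3) := ⟨Nat.prime_three⟩
  obtain ⟨M, hM⟩ := (pow_padicValNat_dvd (p := 3) (n := k.factorial))
  have hM3 : ¬ 3 ∣ M := by
    rintro ⟨M', rfl⟩
    refine pow_succ_padicValNat_not_dvd (p := 3) (Nat.factorial_ne_zero k) ⟨M', ?_⟩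
    conv_lhs => rw [hM]
    ring
  conv_lhs => rw [hM]
  refine Nat.mul_dvd_mul_left _ ?_
  have hcop : Nat.Coprime 3 M := (Nat.Prime.coprime_iff_not_dvd Nat.prime_three).2 hM3
  obtain ⟨u, hu⟩ : ∃ u : ℕ, 3 * u ≡ 1 [MOD M] := by
    rcases Nat.lt_or_ge 1 M with h | h
    · obtain ⟨u, hu⟩ := Nat.exists_mul_mod_eq_one_of_coprime hcop h
      exact ⟨u, by rw [Nat.ModEq, hu.2, Nat.mod_eq_of_lt h]⟩
    · have : M = 1 := by
        have : M ≠ 0 := by rintro rfl; exact hM3 (dvd_zero _)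
        omega
      exact ⟨0, by rw [this]; exact Nat.modEq_one⟩
  have hprod : ∏ s ∈ range k, (3 * s + c) ≡ ∏ s ∈ range k, 3 * (u * c + s) [MOD M] := by
    refine Nat.ModEq.prod fun s _ => ?_
    have := (hu.mul_right c).symm.add_left (3 * s)
    rw [one_mul] at this
    convert this using 1
    ring
  refine (hprod.dvd_iff dvd_rfl).2 ?_
  rw [prod_mul_distrib, ← Nat.ascFactorial_eq_prod_range]
  refine Dvd.dvd.mul_left ?_ _
  exact (Dvd.intro_left _ hM.symm).trans (Nat.factorial_dvd_ascFactorial _ _)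

theorem prod_mul_besselCoeff {ν : ℝ} (h1 : ν < 1) (i j : ℕ) :
    (∏ s ∈ range (i + j), ((s : ℝ) + 1 - ν)) * besselCoeff ν i =
      (∏ s ∈ range j, ((i : ℝ) + s + 1 - ν)) / i.factorial := by
  have h : ∏ s ∈ range i, ((s : ℝ) + 1 - ν) ≠ 0 := by
    refine prod_ne_zero_iff.2 fun s _ => ?_
    have : (0 : ℝ) ≤ s := s.cast_nonneg
    have : (0 : ℝ) < (s : ℝ) + 1 - ν := by linarith
    exact this.ne'
  have hf : (∏ s ∈ range i, ((s : ℝ) + 1)) = i.factorial := by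
    rw [← prod_range_add_one_eq_factorial]; push_cast; rfl
  rw [besselCoeff, prod_inv_distrib, prod_mul_distrib, hf, prod_range_add]
  push_cast
  field_simp

/-- After cancellation two products in progressions of lengths j and i stand over i! j!. Pairing
each factorial with the product of its own length costs 3^(i+j) to clear the thirds and, by
Legendre's formula, at most 3^n for the 3-parts; n + (2n+1) = 3n+1. -/
theorem exists_int_eq_padeCoeff (n i j : ℕ) (hij : i + j = 2 * n + 1) :
    ∃ z : ℕ, (3 : ℝ) ^ (3 * n + 1) * (pochProd (1 / 3) (2 * n + 1) *
      (besselCoeff (1 / 3) i * besselCoeff (-(1 / 3)) j)) = z := by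
  have : Fact (Nat.Prime 3) := ⟨Nat.prime_three⟩
  have hval : padicValNat 3 i.factorial + padicValNat 3 j.factorial ≤ n := by
    have h1 : padicValNat 3 (i.factorial * j.factorial) ≤ padicValNat 3 (i + j).factorial :=
      (padicValNat_dvd_iff_le (Nat.factorial_ne_zero _)).1
        (pow_padicValNat_dvd.trans (Nat.factorial_mul_factorial_dvd_factorial_add i j))
    rw [padicValNat.mul (Nat.factorial_ne_zero _) (Nat.factorial_ne_zero _)] at h1
    have h2 := sub_one_mul_padicValNat_factorial (p := 3) (i + j)
    omega
  obtain ⟨r, hr⟩ := Nat.exists_eq_add_of_le hval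
  obtain ⟨A, hA⟩ := factorial_dvd_three_pow_mul_prod i (3 * j + 4)
  obtain ⟨B, hB⟩ := factorial_dvd_three_pow_mul_prod j (3 * i + 2)
  have hA' : (3 : ℝ) ^ padicValNat 3 i.factorial *
      (3 ^ i * ∏ s ∈ range i, ((j : ℝ) + s + 1 - -(1 / 3))) = i.factorial * A := by
    have : (3 : ℝ) ^ i * ∏ s ∈ range i, ((j : ℝ) + s + 1 - -(1 / 3)) =
        ∏ s ∈ range i, (3 * (s : ℝ) + (3 * j + 4)) := by
      rw [← card_range i, ← prod_const, card_range, ← prod_mul_distrib]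
      refine prod_congr rfl fun s _ => ?_
      ring
    rw [this]
    exact_mod_cast hA
  have hB' : (3 : ℝ) ^ padicValNat 3 j.factorial *
      (3 ^ j * ∏ s ∈ range j, ((i : ℝ) + s + 1 - 1 / 3)) = j.factorial * B := by
    have : (3 : ℝ) ^ j * ∏ s ∈ range j, ((i : ℝ) + s + 1 - 1 / 3) =
        ∏ s ∈ range j, (3 * (s : ℝ) + (3 * i + 2)) := by
      rw [← card_range j, ← prod_const, card_range, ← prod_mul_distrib]
      refine prod_congr rfl fun s _ => ?_
      ring
    rw [this]
    exact_mod_cast hB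
  refine ⟨3 ^ r * (A * B), ?_⟩
  have hp : pochProd (1 / 3) (2 * n + 1) =
      (∏ s ∈ range (i + j), ((s : ℝ) + 1 - 1 / 3)) *
      ∏ s ∈ range (j + i), ((s : ℝ) + 1 - -(1 / 3)) := by
    rw [add_comm j i, hij, ← prod_mul_distrib, pochProd]
    refine prod_congr rfl fun s _ => ?_
    ring
  have h1 := prod_mul_besselCoeff (ν := 1 / 3) (by norm_num) i j
  have h2 := prod_mul_besselCoeff (ν := -(1 / 3)) (by norm_num) j i
  have h3 : pochProd (1 / 3) (2 * n + 1) *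
      (besselCoeff (1 / 3) i * besselCoeff (-(1 / 3)) j) =
      (∏ s ∈ range j, ((i : ℝ) + s + 1 - 1 / 3)) / i.factorial *
      ((∏ s ∈ range i, ((j : ℝ) + s + 1 - -(1 / 3))) / j.factorial) := by
    rw [← h1, ← h2, hp]; ring
  have h4 : (3 : ℝ) ^ (3 * n + 1) = 3 ^ r * (3 ^ padicValNat 3 i.factorial * 3 ^ i) *
      (3 ^ padicValNat 3 j.factorial * 3 ^ j) := by
    rw [show 3 * n + 1 = n + (i + j) by omega]
    nth_rewrite 1 [hr]
    simp only [pow_add]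
    ring
  have hi : (i.factorial : ℝ) ≠ 0 := by positivity
  have hj : (j.factorial : ℝ) ≠ 0 := by positivity
  have hAB : (3 : ℝ) ^ (3 * n + 1) * ((∏ s ∈ range j, ((i : ℝ) + s + 1 - 1 / 3)) *
      ∏ s ∈ range i, ((j : ℝ) + s + 1 - -(1 / 3))) =
      3 ^ r * (i.factorial * A) * (j.factorial * B) := by
    rw [← hA', ← hB', h4]; ring
  rw [h3, div_mul_div_comm, mul_div_assoc', hAB]
  push_cast
  field_simp

/-- Multiplication by (p ± ri)² = P - R ± 2pri preserves the shape ep + fri, so odd degrees reduce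
to degree 1. -/
theorem exists_int_pow_mul_conj_pow {p r : ℝ} {P R : ℤ} (hP : p ^ 2 = P) (hR : r ^ 2 = R)
    (n i j : ℕ) (hij : i + j = 2 * n + 1) :
    ∃ e f : ℤ, ((p : ℂ) + r * Complex.I) ^ i * ((p : ℂ) - r * Complex.I) ^ j =
      e * p + f * r * Complex.I := by
  have hP' : (p : ℂ) ^ 2 = P := by exact_mod_cast congrArg (fun z : ℝ => (z : ℂ)) hP
  have hR' : (r : ℂ) ^ 2 = R := by exact_mod_cast congrArg (fun z : ℝ => (z : ℂ)) hR
  have hI := Complex.I_sq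
  induction n generalizing i j with
  | zero =>
    obtain ⟨rfl, rfl⟩ | ⟨rfl, rfl⟩ : (i = 1 ∧ j = 0) ∨ (i = 0 ∧ j = 1) := by omega
    · exact ⟨1, 1, by push_cast; ring⟩
    · exact ⟨1, -1, by push_cast; ring⟩
  | succ n ih =>
    rcases Nat.lt_or_ge i 2 with hi | hi
    · obtain ⟨k, rfl⟩ : ∃ k, j = k + 2 := ⟨j - 2, by omega⟩
      obtain ⟨e, f, h⟩ := ih i k (by omega)
      refine ⟨e * (P - R) + 2 * f * R, f * (P - R) - 2 * e * P, ?_⟩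
      rw [pow_add, ← mul_assoc, h]
      push_cast
      rw [← hP', ← hR']
      linear_combination (r ^ 2 * (e * p + f * r * Complex.I) - 2 * p * r ^ 2 * f : ℂ) * hI
    · obtain ⟨k, rfl⟩ : ∃ k, i = k + 2 := ⟨i - 2, by omega⟩
      obtain ⟨e, f, h⟩ := ih k j (by omega)
      refine ⟨e * (P - R) - 2 * f * R, f * (P - R) + 2 * e * P, ?_⟩
      rw [pow_add, mul_right_comm, h]
      push_cast
      rw [← hP', ← hR']
      linear_combination (r ^ 2 * (e * p + f * r * Complex.I) + 2 * p * r ^ 2 * f : ℂ) * hI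

/-- Each new factor adds at most r to the imaginary part relative to the modulus. Keeping the factor
r, which is small compared with H, prevents a loss of H/r in the bound for f. -/
theorem abs_im_pow_mul_pow_le {z w : ℂ} {H r : ℝ} (hz : ‖z‖ = H) (hw : ‖w‖ = H)
    (hzr : |z.im| ≤ r) (hwr : |w.im| ≤ r) (i j : ℕ) :
    |(z ^ i * w ^ j).im| * H ≤ ((i + j : ℕ) : ℝ) * r * H ^ (i + j) := by
  have hH : 0 ≤ H := hz ▸ norm_nonneg z
  have step (u v : ℂ) (k : ℕ) (hu : ‖u‖ = H ^ k) (hur : |u.im| * H ≤ k * r * H ^ k)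
      (hv : ‖v‖ = H) (hvr : |v.im| ≤ r) :
      |(u * v).im| * H ≤ ((k + 1 : ℕ) : ℝ) * r * H ^ (k + 1) := by
    rw [Complex.mul_im]
    have h1 : |u.re| ≤ H ^ k := hu ▸ Complex.abs_re_le_norm u
    have h2 : |v.re| ≤ H := hv ▸ Complex.abs_re_le_norm v
    have hr : 0 ≤ r := (abs_nonneg _).trans hvr
    calc |u.re * v.im + u.im * v.re| * H
        ≤ (|u.re| * |v.im| + |u.im| * |v.re|) * H := by
          rw [← abs_mul, ← abs_mul]
          gcongr
          exact abs_add_le _ _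
      _ = |u.re| * |v.im| * H + (|u.im| * H) * |v.re| := by ring
      _ ≤ H ^ k * r * H + (k * r * H ^ k) * H := by gcongr
      _ = _ := by push_cast; ring
  induction j with
  | zero =>
    simp only [pow_zero, mul_one, add_zero]
    induction i with
    | zero => simp
    | succ i ih =>
      rw [pow_succ]
      exact step _ _ _ (by rw [norm_pow, hz]) ih hz hzr
  | succ j ih =>
    rw [pow_succ, ← mul_assoc, ← add_assoc]
    exact step _ _ _ (by rw [norm_mul, norm_pow, norm_pow, hz, hw, pow_add]) ih hw hwr

theorem padeForm_conj (ν : ℝ) (m : ℕ) (x y : ℂ) :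
    conj (padeForm ν m x y) = padeForm ν m (conj x) (conj y) := by
  simp [padeForm, map_sum, Complex.real_smul]

/-- The Padé approximations to the cube root of a unimodular number, for odd degrees and in an
arithmetically normalised form. -/
theorem exists_int_approx {p r H φ : ℝ} {P R : ℤ} (hP : p ^ 2 = P) (hR : r ^ 2 = R)
    (hp : 0 < p) (hr : 0 < r) (hH : 0 < H) (hpH : p = H * Real.cos φ) (hrH : r = H * Real.sin φ)
    (hφ0 : 0 ≤ φ) (hφ : φ ≤ Real.pi) :
    ∃ e f : ℕ → ℤ,
      (∀ n, |(e n : ℝ)| * p ≤ 3 ^ (3 * n + 1) * (2 * n + 1).centralBinom * H ^ (2 * n + 1)) ∧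
      (∀ n, |(f n : ℝ)| ≤
        3 ^ (3 * n + 1) * (2 * n + 1).centralBinom * (2 * n + 1) * H ^ (2 * n)) ∧
      (∀ n, |(f n : ℝ) * r * Real.cos (φ / 3) - e n * p * Real.sin (φ / 3)| ≤
        3 ^ (3 * n + 1) * H ^ (2 * n + 1) * (1 / 3 * φ * (2 * (1 - Real.cos φ)) ^ (2 * n + 1))) ∧
      ∀ n, e n * f (n + 1) - e (n + 1) * f n ≠ 0 := by
  set U : ℂ := (p : ℂ) + r * Complex.I with hU
  set V : ℂ := (p : ℂ) - r * Complex.I with hV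
  have hUV : conj U = V := by simp [hU, hV, sub_eq_add_neg]
  have hVU : conj V = U := by simp [hU, hV, sub_eq_add_neg]
  have hUe : U = H * Complex.exp (φ * Complex.I) := by
    rw [hU, hpH, hrH, Complex.exp_mul_I]; push_cast; ring
  have hVe : V = H * Complex.exp (-(φ * Complex.I)) := by
    rw [hV, hpH, hrH, ← neg_mul, Complex.exp_mul_I, Complex.cos_neg, Complex.sin_neg]
    push_cast; ring
  have hUn : ‖U‖ = H := by
    rw [hUe, norm_mul, Complex.norm_exp_ofReal_mul_I, Complex.norm_real, mul_one,
      Real.norm_of_nonneg hH.le]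
  have hVn : ‖V‖ = H := by rw [← hUV, Complex.norm_conj, hUn]
  have hUim : |U.im| ≤ r := by simp [hU, abs_of_pos hr]
  have hVim : |V.im| ≤ r := by simp [hV, abs_of_pos hr]
  set c : ℕ → ℝ := fun n => 3 ^ (3 * n + 1) * pochProd (1 / 3) (2 * n + 1) with hc
  have hc0 (n : ℕ) : 0 < c n := mul_pos (by positivity) (pochProd_pos (by norm_num) (by norm_num) _)
  set A : ℕ → ℂ := fun n => (c n : ℂ) * padeForm (1 / 3) (2 * n + 1) U V with hA
  have hsum (n : ℕ) : ∑ ij ∈ antidiagonal (2 * n + 1),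
      c n * (besselCoeff (1 / 3) ij.1 * besselCoeff (-(1 / 3)) ij.2) =
      3 ^ (3 * n + 1) * (2 * n + 1).centralBinom := by
    rw [← mul_sum, ← sum_besselCoeff (ν := 1 / 3) (by norm_num) (by norm_num), hc]
    ring
  have hcoef0 (n : ℕ) (ij : ℕ × ℕ) :
      0 ≤ c n * (besselCoeff (1 / 3) ij.1 * besselCoeff (-(1 / 3)) ij.2) :=
    (mul_pos (hc0 n) (mul_pos (besselCoeff_pos (by norm_num) _)
      (besselCoeff_pos (by norm_num) _))).le
  have hAsum (n : ℕ) : A n = ∑ ij ∈ antidiagonal (2 * n + 1),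
      (((c n * (besselCoeff (1 / 3) ij.1 * besselCoeff (-(1 / 3)) ij.2) : ℝ)) : ℂ) *
        (U ^ ij.1 * V ^ ij.2) := by
    simp only [hA, padeForm, mul_sum, Complex.real_smul]
    refine sum_congr rfl fun ij _ => ?_
    push_cast; ring
  have hint (n : ℕ) : ∃ ef : ℤ × ℤ, A n = ef.1 * p + ef.2 * r * Complex.I := by
    have : ∀ s : Finset (ℕ × ℕ), s ⊆ antidiagonal (2 * n + 1) → ∃ ef : ℤ × ℤ,
        ∑ ij ∈ s, (((c n * (besselCoeff (1 / 3) ij.1 * besselCoeff (-(1 / 3)) ij.2) : ℝ)) : ℂ) *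
        (U ^ ij.1 * V ^ ij.2) = ef.1 * p + ef.2 * r * Complex.I := by
      intro s
      induction s using Finset.induction_on with
      | empty => exact fun _ => ⟨(0, 0), by simp⟩
      | insert a s ha ih =>
        intro hs
        obtain ⟨ef, hef⟩ := ih ((subset_insert a s).trans hs)
        have ham := mem_antidiagonal.1 (hs (mem_insert_self a s))
        obtain ⟨z, hz⟩ := exists_int_eq_padeCoeff n a.1 a.2 ham
        obtain ⟨e, f, hef'⟩ := exists_int_pow_mul_conj_pow hP hR n a.1 a.2 ham
        refine ⟨(z * e + ef.1, z * f + ef.2), ?_⟩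
        rw [sum_insert ha, hef, hef', hc, mul_assoc, hz]
        push_cast
        ring
    rw [hAsum]
    exact this _ Subset.rfl
  choose ef hef using hint
  have hre (n : ℕ) : (A n).re = (ef n).1 * p := by rw [hef]; simp
  have him (n : ℕ) : (A n).im = (ef n).2 * r := by rw [hef]; simp
  refine ⟨fun n => (ef n).1, fun n => (ef n).2, fun n => ?_, fun n => ?_, fun n => ?_,
    fun n => ?_⟩
  · have habs : |((ef n).1 : ℝ)| * p = |(A n).re| := by rw [hre, abs_mul, abs_of_pos hp]
    rw [habs]
    refine (Complex.abs_re_le_norm _).trans ?_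
    rw [hAsum, ← hsum, sum_mul]
    refine (norm_sum_le _ _).trans (sum_le_sum fun ij hij => ?_)
    rw [norm_mul, Complex.norm_real, Real.norm_of_nonneg (hcoef0 n ij), norm_mul, norm_pow,
      norm_pow, hUn, hVn, ← pow_add, mem_antidiagonal.1 hij]
  · have h1 : |(A n).im| * H ≤
        3 ^ (3 * n + 1) * (2 * n + 1).centralBinom * ((2 * n + 1) * r * H ^ (2 * n + 1)) := by
      rw [hAsum, ← hsum, sum_mul, Complex.im_sum]
      refine (mul_le_mul_of_nonneg_right (abs_sum_le_sum_abs _ _) hH.le).trans ?_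
      rw [sum_mul]
      refine sum_le_sum fun ij hij => ?_
      rw [Complex.im_ofReal_mul, abs_mul, abs_of_nonneg (hcoef0 n ij), mul_assoc]
      have := abs_im_pow_mul_pow_le hUn hVn hUim hVim ij.1 ij.2
      rw [mem_antidiagonal.1 hij] at this
      push_cast at this
      exact mul_le_mul_of_nonneg_left this (hcoef0 n ij)
    rw [him, abs_mul, abs_of_pos hr] at h1
    have hrH' : 0 < r * H := mul_pos hr hH
    refine le_of_mul_le_mul_right ?_ hrH'
    calc |((ef n).2 : ℝ)| * (r * H) = |((ef n).2 : ℝ)| * r * H := by ring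
      _ ≤ _ := h1
      _ = _ := by ring
  · have hform : padeForm (1 / 3) (2 * n + 1) U V = (H : ℂ) ^ (2 * n + 1) *
        padeForm (1 / 3) (2 * n + 1) (Complex.exp (φ * Complex.I))
          (Complex.exp (-(φ * Complex.I))) := by
      rw [padeForm, padeForm, mul_sum, hUe, hVe]
      refine sum_congr rfl fun ij hij => ?_
      rw [mul_pow, mul_pow, ← mem_antidiagonal.1 hij, pow_add, mul_smul_comm]
      congr 1
      ring
    have hrem : (A n * Complex.exp (-((1 / 3 : ℝ) * φ * Complex.I))).im =
        c n * H ^ (2 * n + 1) * padeRemainder (1 / 3) (2 * n + 1) φ := by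
      rw [padeRemainder_eq_im, ← Complex.im_ofReal_mul]
      congr 1
      simp only [hA]
      rw [hform]
      push_cast
      ring
    have hexp : Complex.exp (-((1 / 3 : ℝ) * φ * Complex.I)) =
        Real.cos (φ / 3) - Real.sin (φ / 3) * Complex.I := by
      have : -((1 / 3 : ℝ) * φ * Complex.I) = ((-(φ / 3) : ℝ) : ℂ) * Complex.I := by
        push_cast; ring
      rw [this, Complex.exp_mul_I, ← Complex.ofReal_cos, ← Complex.ofReal_sin, Real.cos_neg,
        Real.sin_neg]
      push_cast; ring
    have hL : (A n * Complex.exp (-((1 / 3 : ℝ) * φ * Complex.I))).im =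
        (ef n).2 * r * Real.cos (φ / 3) - (ef n).1 * p * Real.sin (φ / 3) := by
      rw [hexp, Complex.mul_im, hre, him]
      simp [-Complex.ofReal_cos, -Complex.ofReal_sin]
      ring
    rw [← hL, hrem, abs_mul, abs_of_nonneg (mul_nonneg (hc0 n).le (by positivity))]
    calc c n * H ^ (2 * n + 1) * |padeRemainder (1 / 3) (2 * n + 1) φ|
        = 3 ^ (3 * n + 1) * H ^ (2 * n + 1) *
          (pochProd (1 / 3) (2 * n + 1) * |padeRemainder (1 / 3) (2 * n + 1) φ|) := by
          simp only [hc]; ring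
      _ ≤ _ := mul_le_mul_of_nonneg_left (pochProd_mul_abs_padeRemainder_le (ν := 1 / 3)
          (by norm_num) (by norm_num) _ hφ0 hφ) (by positivity)
  · intro h0
    have hne : U ≠ V := by
      intro h
      have := congrArg Complex.im h
      simp [hU, hV] at this
      linarith
    -- Consecutive odd degrees differ by two, so the determinant carries the factor U + V = 2p.
    have hne' : U + V ≠ 0 := by
      intro h
      have := congrArg Complex.re h
      simp [hU, hV] at this
      linarith
    have hdet := padeForm_det_add_two_ne_zero (ν := 1 / 3) (by norm_num) (by norm_num) hne hne'
      (2 * n + 1)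
    have hcj (m : ℕ) : padeForm (1 / 3) m V U = conj (padeForm (1 / 3) m U V) := by
      rw [padeForm_conj, hUV, hVU]
    have hconj (n : ℕ) : (c n : ℂ) * padeForm (1 / 3) (2 * n + 1) V U =
        (ef n).1 * p - (ef n).2 * r * Complex.I := by
      have := congrArg conj (hef n)
      simp only [hA, map_mul, map_add, Complex.conj_ofReal, Complex.conj_I, map_intCast] at this
      rw [hcj, this]
      ring
    have hne1 : (c n : ℂ) ≠ 0 := by exact_mod_cast (hc0 n).ne'
    have hne2 : (c (n + 1) : ℂ) ≠ 0 := by exact_mod_cast (hc0 (n + 1)).ne'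
    refine mul_ne_zero (mul_ne_zero hne1 hne2) hdet ?_
    have h1 := hef n
    have h2 := hef (n + 1)
    have h3 := hconj n
    have h4 := hconj (n + 1)
    simp only [hA] at h1 h2
    rw [show 2 * (n + 1) + 1 = 2 * n + 1 + 2 by ring] at h2 h4
    have h0' : ((ef n).1 : ℂ) * (ef (n + 1)).2 - (ef (n + 1)).1 * (ef n).2 = 0 := by
      exact_mod_cast h0
    calc (c n : ℂ) * c (n + 1) * _ =
      ((c (n + 1) : ℂ) * padeForm (1 / 3) (2 * n + 1 + 2) U V) *
        ((c n : ℂ) * padeForm (1 / 3) (2 * n + 1) V U)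
      - ((c (n + 1) : ℂ) * padeForm (1 / 3) (2 * n + 1 + 2) V U) *
        ((c n : ℂ) * padeForm (1 / 3) (2 * n + 1) U V) := by ring
      _ = 0 := by
        rw [h1, h2, h3, h4]
        linear_combination (2 * p * r * Complex.I : ℂ) * h0'

/-! ### The root of the cubic -/

section Root

variable {a t : ℝ}

/-- The angle `arctan (a ^ (3/2) / (t √(t⁴ + 3 a t² + 3 a²)))`. -/
noncomputable def angle (a t : ℝ) : ℝ :=
  Real.arctan (a * √a / (t * √(t ^ 4 + 3 * a * t ^ 2 + 3 * a ^ 2)))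

theorem angle_pos (ha : 0 < a) (ht : 0 < t) : 0 < angle a t :=
  Real.arctan_pos.2 (by positivity)

theorem angle_lt (a t : ℝ) : angle a t < Real.pi / 2 := Real.arctan_lt_pi_div_two _

theorem sq_add_sq_eq (ha : 0 < a) :
    (t * √(t ^ 4 + 3 * a * t ^ 2 + 3 * a ^ 2)) ^ 2 + (a * √a) ^ 2 = (t ^ 2 + a) ^ 3 := by
  rw [mul_pow, mul_pow, Real.sq_sqrt (by positivity), Real.sq_sqrt ha.le]
  ring

theorem sqrt_mul_cos_angle (ha : 0 < a) (ht : 0 < t) :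
    t * √(t ^ 4 + 3 * a * t ^ 2 + 3 * a ^ 2) =
      √((t ^ 2 + a) ^ 3) * Real.cos (angle a t) := by
  have hp : 0 < t * √(t ^ 4 + 3 * a * t ^ 2 + 3 * a ^ 2) := by positivity
  rw [angle, Real.cos_arctan, ← sq_add_sq_eq ha]
  set p := t * √(t ^ 4 + 3 * a * t ^ 2 + 3 * a ^ 2)
  have h : p ^ 2 + (a * √a) ^ 2 = p ^ 2 * (1 + (a * √a / p) ^ 2) := by
    field_simp
  have h1 : √(1 + (a * √a / p) ^ 2) ≠ 0 := by positivity
  rw [h, Real.sqrt_mul (by positivity), Real.sqrt_sq hp.le]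
  field_simp

theorem sqrt_mul_sin_angle (ha : 0 < a) (ht : 0 < t) :
    a * √a = √((t ^ 2 + a) ^ 3) * Real.sin (angle a t) := by
  have hp : 0 < t * √(t ^ 4 + 3 * a * t ^ 2 + 3 * a ^ 2) := by positivity
  have hc : 0 < Real.cos (angle a t) := Real.cos_arctan_pos _
  have h := Real.tan_arctan (a * √a / (t * √(t ^ 4 + 3 * a * t ^ 2 + 3 * a ^ 2)))
  rw [← angle, Real.tan_eq_sin_div_cos] at h
  rw [div_eq_div_iff hc.ne' hp.ne', sqrt_mul_cos_angle ha ht] at h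
  apply mul_right_cancel₀ hc.ne'
  linear_combination -h

/-- The real solution of the cubic equation that exceeds `t / 2`. -/
noncomputable def root (a t : ℝ) : ℝ :=
  a * (t ^ 2 + a) / (a * t + √a * √(t ^ 4 + 3 * a * t ^ 2 + 3 * a ^ 2) *
    Real.tan (angle a t / 3))

theorem tan_third_pos (ha : 0 < a) (ht : 0 < t) : 0 < Real.tan (angle a t / 3) := by
  have h1 := angle_pos ha ht
  have h2 := angle_lt a t
  exact Real.tan_pos_of_pos_of_lt_pi_div_two (by linarith) (by linarith)

theorem tan_third_lt (ha : 0 < a) (ht : 0 < t) : Real.tan (angle a t / 3) <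
    a * √a / (t * √(t ^ 4 + 3 * a * t ^ 2 + 3 * a ^ 2)) := by
  have h1 := angle_pos ha ht
  have h2 := angle_lt a t
  rw [← Real.tan_arctan (a * √a / (t * √(t ^ 4 + 3 * a * t ^ 2 + 3 * a ^ 2))), ← angle]
  exact Real.tan_lt_tan_of_lt_of_lt_pi_div_two (by linarith) h2 (by linarith)

theorem root_eq_zero (ha : 0 < a) (ht : 0 < t) :
    3 * root a t ^ 3 - 3 * t * root a t ^ 2 - 3 * a * root a t + a * t = 0 := by
  have hT := tan_third_pos ha ht
  have h1 := angle_pos ha ht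
  have h2 := angle_lt a t
  have hC : 0 < Real.cos (angle a t / 3) :=
    Real.cos_pos_of_mem_Ioo ⟨by linarith, by linarith⟩
  have htriple : a * √a * (1 - 3 * Real.tan (angle a t / 3) ^ 2) =
      t * √(t ^ 4 + 3 * a * t ^ 2 + 3 * a ^ 2) *
        (3 * Real.tan (angle a t / 3) - Real.tan (angle a t / 3) ^ 3) := by
    have hx : a * √a * Real.cos (angle a t) =
        t * √(t ^ 4 + 3 * a * t ^ 2 + 3 * a ^ 2) * Real.sin (angle a t) := by
      rw [sqrt_mul_cos_angle ha ht, sqrt_mul_sin_angle ha ht]; ring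
    rw [show angle a t = 3 * (angle a t / 3) by ring, Real.cos_three_mul,
      Real.sin_three_mul] at hx
    have hCS := Real.sin_sq_add_cos_sq (angle a t / 3)
    rw [Real.tan_eq_sin_div_cos]
    generalize Real.cos (angle a t / 3) = C at *
    generalize Real.sin (angle a t / 3) = S at *
    generalize √(t ^ 4 + 3 * a * t ^ 2 + 3 * a ^ 2) = l at *
    generalize √a = s at *
    field_simp
    linear_combination hx + (-3 * a * s * C + (-3 * S) * t * l) * hCS
  have hs : √a ^ 2 = a := Real.sq_sqrt ha.le
  have hl : √(t ^ 4 + 3 * a * t ^ 2 + 3 * a ^ 2) ^ 2 = t ^ 4 + 3 * a * t ^ 2 + 3 * a ^ 2 :=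
    Real.sq_sqrt (by positivity)
  have hs0 : 0 < √a := Real.sqrt_pos.2 ha
  have hl0 : 0 < √(t ^ 4 + 3 * a * t ^ 2 + 3 * a ^ 2) := by positivity
  unfold root
  generalize Real.tan (angle a t / 3) = T at *
  generalize √(t ^ 4 + 3 * a * t ^ 2 + 3 * a ^ 2) = l at *
  generalize √a = s at *
  -- In terms of c = slT the triple-angle relation has no square roots left; x = a(t²+a)/(at+c)
  -- carries it to the cubic.
  obtain ⟨c, hc⟩ : ∃ c, c = s * l * T := ⟨_, rfl⟩
  have hc0 : 0 < c := by rw [hc]; positivity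
  have hrel : t * c ^ 3 - 3 * a ^ 2 * c ^ 2
      - 3 * t * a * (t ^ 4 + 3 * a * t ^ 2 + 3 * a ^ 2) * c
      + a ^ 3 * (t ^ 4 + 3 * a * t ^ 2 + 3 * a ^ 2) = 0 := by
    rw [← hl, hc, ← hs]
    rw [← hs] at htriple
    linear_combination l ^ 2 * s ^ 3 * htriple
  rw [← hc]
  have hd : a * t + c ≠ 0 := by positivity
  field_simp
  linear_combination a * hrel

theorem half_lt_root (ha : 0 < a) (ht : 0 < t) : t / 2 < root a t := by
  have hT := tan_third_pos ha ht
  have hT2 := tan_third_lt ha ht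
  have hs0 : 0 < √a := Real.sqrt_pos.2 ha
  have hl0 : 0 < √(t ^ 4 + 3 * a * t ^ 2 + 3 * a ^ 2) := by positivity
  have hs : √a ^ 2 = a := Real.sq_sqrt ha.le
  unfold root
  generalize Real.tan (angle a t / 3) = T at *
  generalize √(t ^ 4 + 3 * a * t ^ 2 + 3 * a ^ 2) = l at *
  generalize √a = s at *
  rw [lt_div_iff₀ (by positivity)] at hT2 ⊢
  -- From tan(φ/3) < tan φ = r/p.
  have : t * (s * l * T) < a ^ 2 := by
    calc t * (s * l * T) = s * (T * (t * l)) := by ring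
      _ < s * (a * s) := by gcongr
      _ = a ^ 2 := by rw [← hs]; ring
  nlinarith [mul_pos ha ht, mul_pos (mul_pos ha ht) ht]

theorem root_unique (ha : 0 < a) (ht : 0 < t) (hat : 9 * a ≤ t ^ 2) {x y : ℝ}
    (hx : 3 * x ^ 3 - 3 * t * x ^ 2 - 3 * a * x + a * t = 0) (hx2 : t / 2 < x)
    (hy : 3 * y ^ 3 - 3 * t * y ^ 2 - 3 * a * y + a * t = 0) (hy2 : t / 2 < y) : x = y := by
  by_contra hne
  have h1 : x ^ 2 + x * y + y ^ 2 - t * (x + y) - a = 0 := by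
    have : 3 * (x - y) ≠ 0 := mul_ne_zero (by norm_num) (sub_ne_zero.2 hne)
    apply mul_left_cancel₀ this
    linear_combination hx - hy
  have h2 : 3 * x * y * (x + y - t) = a * t := by
    linear_combination (3 * x) * h1 - hx
  -- With u = x - t/2 and v = y - t/2, `h2` gives u + v < 4a/(3t) ≤ 4t/27, while `h1` says u² + uv +
  -- v² + t(u+v)/2 = t²/4 + a: the left side is too small.
  nlinarith [mul_pos (sub_pos.2 hx2) (sub_pos.2 hy2), mul_pos ha ht,
    mul_pos (mul_pos ht ht) (sub_pos.2 hx2), mul_pos (mul_pos ht ht) (sub_pos.2 hy2)]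

end Root

/-! ### Comparison with the stated constants -/

theorem c1_pos : 0 < c1 := by
  unfold c1
  positivity

theorem c1_sq_mul_le : c1 ^ 2 * Real.exp 1 ^ 2 ≤ 1 / 3 := by
  have h0 : 0 ≤ ∑' p, primeTerm p := by
    refine tsum_nonneg fun p => ?_
    have hp : (5 : ℝ) ≤ ((p : ℕ) : ℝ) := by exact_mod_cast p.2.2
    refine div_nonneg (Real.log_nonneg (by linarith)) ?_
    nlinarith
  have h1 : Real.exp (-∑' p, primeTerm p) ≤ 1 := Real.exp_le_one_iff.2 (by linarith)
  have h3 : √(3 : ℝ) ^ 2 = 3 := Real.sq_sqrt (by norm_num)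
  have h : c1 ^ 2 * Real.exp 1 ^ 2 = Real.exp (-∑' p, primeTerm p) ^ 2 / 3 := by
    unfold c1
    rw [mul_pow, div_pow, mul_pow, h3]
    field_simp
  rw [h]
  gcongr
  exact pow_le_one₀ (Real.exp_pos _).le h1

theorem le_c6 {a t : ℝ} (ha : 0 < a) : 432 * (t ^ 2 + a) ^ 3 ≤ c6 a t := by
  have h0 : 0 < c1 ^ 2 * Real.exp 1 ^ 2 := by have := c1_pos; positivity
  unfold c6
  rw [le_div_iff₀ h0]
  have := c1_sq_mul_le
  have hW : 0 < (t ^ 2 + a) ^ 3 := by positivity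
  nlinarith

theorem le_inv_c7 {a t : ℝ} (ha : 0 < a) (ht : 0 < t) :
    27 * a ^ 6 * (t ^ 2 + a) / (t ^ 4 * (t ^ 2 + 2 * a) ^ 2) ≤ (c7 a t)⁻¹ := by
  have h0 : 0 < c1 ^ 2 * Real.exp 1 ^ 2 := by have := c1_pos; positivity
  unfold c7
  rw [inv_div, div_le_div_iff₀ (by positivity) (by positivity)]
  have := c1_sq_mul_le
  have hW : 0 < a ^ 6 * (t ^ 2 + a) * (t ^ 4 * (t ^ 2 + 2 * a) ^ 2) := by positivity
  nlinarith

theorem tau3_pos {a t : ℝ} (ha : 0 < a) (ht : 0 < t) : 0 < tau3 a t := by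
  unfold tau3; positivity

theorem tau4_pos {a t : ℝ} (ha : 0 < a) (ht : 0 < t) : 0 < tau4 a t := by
  unfold tau4; positivity

theorem le_tau4 {a t : ℝ} (ha : 0 < a) (ht : 0 < t) :
    8 * a ^ 4 / (t * (t ^ 2 + a) ^ 2) ≤ tau4 a t := by
  unfold tau4
  have hpi : √Real.pi ≤ 2 := by
    rw [Real.sqrt_le_left (by norm_num)]
    linarith [Real.pi_le_four]
  have h3 : 1 ≤ √(3 : ℝ) := Real.one_le_sqrt.2 (by norm_num)
  have he : 1 ≤ Real.exp 1 ^ 2 := one_le_pow₀ (Real.one_le_exp (by norm_num))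
  have hpi0 : 0 < √Real.pi := Real.sqrt_pos.2 Real.pi_pos
  have h105 : 105 ≤ 105 * √3 * Real.exp 1 ^ 2 := by nlinarith
  calc 8 * a ^ 4 / (t * (t ^ 2 + a) ^ 2)
      ≤ 105 * a ^ 4 / (2 * 2 * t * (t ^ 2 + 2 * a) * (3 * t ^ 2 + a)) := by
        rw [div_le_div_iff₀ (by positivity) (by positivity)]
        have h : 32 * ((t ^ 2 + 2 * a) * (3 * t ^ 2 + a)) ≤ 105 * (t ^ 2 + a) ^ 2 := by
          nlinarith [mul_pos ha (pow_pos ht 2), sq_nonneg t, sq_nonneg a, sq_nonneg (t ^ 2)]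
        have h4 : 0 < a ^ 4 * t := by positivity
        nlinarith
    _ ≤ _ := by gcongr

/-! ### Denominators and errors of the approximations -/

theorem root_approx_denom_bound {a t e f C W h p : ℝ} (n : ℕ) (hn : 1 ≤ n) (ha : 0 < a) (ht : 0 < t)
    (hat : 9 * a ≤ t ^ 2) (hW : W = (t ^ 2 + a) ^ 3) (hp : 0 < p) (hC : 0 < C) (hh : h ^ 2 = W)
    (hpW : p ^ 2 + a ^ 3 = W)
    (he : |e| * p ≤ 3 ^ (3 * n + 1) * C * h ^ (2 * n + 1))
    (hf : |f| ≤ 3 ^ (3 * n + 1) * C * (2 * n + 1) * h ^ (2 * n))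
    (hCb : C ^ 2 * (2 * ((2 * n + 1 : ℕ) : ℝ) + 1) ≤ 16 ^ (2 * n + 1)) :
    |t ^ 2 * e + a * f| ≤ tau3 a t * √n * (432 * (t ^ 2 + a) ^ 3) ^ n := by
  have hn1 : (1 : ℝ) ≤ n := by exact_mod_cast hn
  have hW0 : 0 < W := by rw [hW]; positivity
  have hW1000 : 1000 * a ^ 3 ≤ W := by
    rw [hW]
    calc 1000 * a ^ 3 = (9 * a + a) ^ 3 := by ring
      _ ≤ _ := by gcongr
  -- p² = W - a³ ≥ 0.999 W, because t² ≥ 9a.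
  have hhp : h ≤ 1.001 * p := by
    refine le_of_sq_le_sq ?_ (by positivity)
    rw [hh]
    nlinarith
  have he' : |e| ≤ 3 ^ (3 * n + 1) * C * W ^ n * 1.001 := by
    refine le_of_mul_le_mul_right (he.trans ?_) hp
    rw [pow_succ h, pow_mul h, hh]
    calc 3 ^ (3 * n + 1) * C * (W ^ n * h) ≤ 3 ^ (3 * n + 1) * C * (W ^ n * (1.001 * p)) := by
          gcongr
      _ = _ := by ring
  rw [pow_mul h, hh] at hf
  have hQ : |t ^ 2 * e + a * f| ≤
      3 * 27 ^ n * W ^ n * (C * (1.001 * t ^ 2 + a * (2 * n + 1))) := by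
    calc |t ^ 2 * e + a * f| ≤ t ^ 2 * |e| + a * |f| := by
          refine (abs_add_le _ _).trans ?_
          rw [abs_mul, abs_mul, abs_of_pos ha, abs_of_pos (pow_pos ht 2)]
      _ ≤ t ^ 2 * (3 ^ (3 * n + 1) * C * W ^ n * 1.001) +
          a * (3 ^ (3 * n + 1) * C * (2 * n + 1) * W ^ n) := by gcongr
      _ = _ := by
          rw [pow_succ 3 (3 * n), pow_mul]; norm_num; ring
  have hpi0 : 0 < √Real.pi := Real.sqrt_pos.2 Real.pi_pos
  have hpi : √Real.pi ^ 2 ≤ 3.1416 := by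
    rw [Real.sq_sqrt Real.pi_pos.le]
    exact Real.pi_lt_d4.le
  have hn2 : √(n : ℝ) ^ 2 = n := Real.sq_sqrt (by positivity)
  have hmain : 3 * (C * (1.001 * t ^ 2 + a * (2 * n + 1))) * √Real.pi ≤
      4 * (3 * t ^ 2 + a) * √n * 16 ^ n := by
    refine le_of_sq_le_sq ?_ (by positivity)
    have hC2 : C ^ 2 * (4 * n + 3) ≤ 16 * 256 ^ n := by
      calc C ^ 2 * (4 * n + 3) = C ^ 2 * (2 * ((2 * n + 1 : ℕ) : ℝ) + 1) := by push_cast; ring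
        _ ≤ 16 ^ (2 * n + 1) := hCb
        _ = 16 * 256 ^ n := by rw [pow_succ, pow_mul]; norm_num; ring
    -- Uses a ≤ t²/9, with 1.001 + 1/9 and 2/9 rounded up.
    have hlin : 1.001 * t ^ 2 + a * (2 * n + 1) ≤ t ^ 2 * (1.1122 + 0.2223 * n) := by nlinarith
    have hquad : 3.1416 * (1.1122 + 0.2223 * (n : ℝ)) ^ 2 ≤ n * (4 * n + 3) := by nlinarith
    have h43 : (0 : ℝ) < 4 * n + 3 := by positivity
    refine le_of_mul_le_mul_right ?_ h43
    calc (3 * (C * (1.001 * t ^ 2 + a * (2 * n + 1))) * √Real.pi) ^ 2 * (4 * n + 3)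
        = 9 * (C ^ 2 * (4 * n + 3)) * ((1.001 * t ^ 2 + a * (2 * n + 1)) ^ 2 * √Real.pi ^ 2) := by
          ring
      _ ≤ 9 * (16 * 256 ^ n) * ((t ^ 2 * (1.1122 + 0.2223 * n)) ^ 2 * 3.1416) := by gcongr
      _ = 144 * 256 ^ n * t ^ 4 * (3.1416 * (1.1122 + 0.2223 * (n : ℝ)) ^ 2) := by ring
      _ ≤ 144 * 256 ^ n * t ^ 4 * (n * (4 * n + 3)) := by gcongr
      _ = 16 * (3 * t ^ 2) ^ 2 * n * 256 ^ n * (4 * n + 3) := by ring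
      _ ≤ 16 * (3 * t ^ 2 + a) ^ 2 * n * 256 ^ n * (4 * n + 3) := by gcongr; linarith
      _ = (4 * (3 * t ^ 2 + a) * √n * 16 ^ n) ^ 2 * (4 * n + 3) := by
          have h256 : ((16 : ℝ) ^ n) ^ 2 = 256 ^ n := by rw [pow_right_comm]; norm_num
          rw [mul_pow, mul_pow, hn2, h256]; ring
  refine hQ.trans ?_
  unfold tau3
  rw [← hW]
  calc 3 * 27 ^ n * W ^ n * (C * (1.001 * t ^ 2 + a * (2 * n + 1)))
      = 27 ^ n * W ^ n * (3 * (C * (1.001 * t ^ 2 + a * (2 * n + 1)))) := by ring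
    _ ≤ 27 ^ n * W ^ n * (4 * (3 * t ^ 2 + a) * √n * 16 ^ n / √Real.pi) := by
        gcongr
        rw [le_div_iff₀ hpi0]
        exact hmain
    _ = 4 * (3 * t ^ 2 + a) / √Real.pi * √n * (432 * W) ^ n := by
        rw [show (432 : ℝ) = 27 * 16 by norm_num, mul_pow, mul_pow]; ring

/-- Both bounds come from (1 - γ)(1 + γ) = σ². The second is nearly sharp and is raised to the power
2n, where it yields the base of c₇; the first, cruder one is used once. -/
theorem one_sub_bounds {a t W γ σ : ℝ} (ha : 0 < a) (ht : 0 < t) (hW : W = (t ^ 2 + a) ^ 3)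
    (hσ : W * σ ^ 2 = a ^ 3) (hsc : σ ^ 2 + γ ^ 2 = 1) (hγ0 : 0 < γ) (hγ1 : γ ≤ 1) :
    2 * (1 - γ) ≤ 2 * a ^ 3 / W ∧
    2 * (1 - γ) ≤ a ^ 3 / ((t ^ 2 + a) * (t ^ 2 * (t ^ 2 + 2 * a))) := by
  have hWpos : 0 < W := by rw [hW]; positivity
  have h5 : 0 ≤ 1 - γ := by linarith
  have hσ2 : σ ^ 2 = (1 - γ) * (1 + γ) := by linear_combination hsc
  constructor
  · rw [le_div_iff₀ hWpos]
    have h1 : 1 - γ ≤ σ ^ 2 := by rw [hσ2]; nlinarith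
    calc 2 * (1 - γ) * W ≤ 2 * σ ^ 2 * W := by gcongr
      _ = 2 * a ^ 3 := by rw [← hσ]; ring
  · rw [le_div_iff₀ (by positivity)]
    have h2 : (t ^ 2 + a) * (t ^ 2 * (t ^ 2 + 2 * a)) ≤ W * γ ^ 2 := by
      have h3 : W * γ ^ 2 = W - a ^ 3 := by
        rw [← hσ]; linear_combination W * hsc
      have h4 : W - a ^ 3 = (t ^ 2 + a) * (t ^ 2 * (t ^ 2 + 2 * a)) + a ^ 2 * t ^ 2 := by
        rw [hW]; ring
      rw [h3, h4]
      exact le_add_of_nonneg_right (by positivity)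
    have h6 : 2 * γ ^ 2 ≤ 1 + γ := by nlinarith
    calc 2 * (1 - γ) * ((t ^ 2 + a) * (t ^ 2 * (t ^ 2 + 2 * a))) ≤ 2 * (1 - γ) * (W * γ ^ 2) := by
          gcongr
      _ = W * ((1 - γ) * (2 * γ ^ 2)) := by ring
      _ ≤ W * ((1 - γ) * (1 + γ)) := by gcongr
      _ = a ^ 3 := by rw [← hσ2, hσ]

theorem error_algebra {a t W H s φ δ D C X : ℝ} (n : ℕ) (ha : 0 < a) (ht : 0 < t)
    (hW : W = (t ^ 2 + a) ^ 3) (hs : s ^ 2 = a) (hs0 : 0 < s) (hH : H ^ 2 = W) (hH0 : 0 < H)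
    (hHφ : H * φ ≤ 2 * (a * s)) (hφ : 0 < φ) (hδ : 0 ≤ δ) (hδ1 : δ ≤ 2 * a ^ 3 / W)
    (hδ2 : δ ≤ a ^ 3 / ((t ^ 2 + a) * (t ^ 2 * (t ^ 2 + 2 * a))))
    (hC : 1 / 2 ≤ C) (hD : a * t ≤ D)
    (hX : |X| ≤ 3 ^ (3 * n + 1) * H ^ (2 * n + 1) * (1 / 3 * φ * δ ^ (2 * n + 1))) :
    |(t ^ 2 + a) * s / (C * D) * X| ≤ 8 * a ^ 4 / (t * (t ^ 2 + a) ^ 2) *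
        (27 * a ^ 6 * (t ^ 2 + a) / (t ^ 4 * (t ^ 2 + 2 * a) ^ 2)) ^ n := by
  have hWpos : 0 < W := by rw [hW]; positivity
  have hat : 0 < a * t := mul_pos ha ht
  have hX2 : |X| ≤ (27 * (W * δ ^ 2)) ^ n * ((H * φ) * δ) := by
    refine hX.trans (le_of_eq ?_)
    rw [pow_succ, pow_mul, pow_succ H, pow_mul H, pow_succ δ, pow_mul δ, hH, mul_pow, mul_pow]
    norm_num
    ring
  have hbase : 27 * (W * δ ^ 2) ≤
      27 * a ^ 6 * (t ^ 2 + a) / (t ^ 4 * (t ^ 2 + 2 * a) ^ 2) := by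
    calc 27 * (W * δ ^ 2)
        ≤ 27 * (W * (a ^ 3 / ((t ^ 2 + a) * (t ^ 2 * (t ^ 2 + 2 * a)))) ^ 2) := by gcongr
      _ = _ := by rw [hW]; field_simp
  have hcoef : (t ^ 2 + a) * s / (C * D) ≤ (t ^ 2 + a) * s / (1 / 2 * (a * t)) := by
    gcongr
  have hC0 : 0 < C := by linarith
  have hD0 : 0 < D := by linarith
  rw [abs_mul, abs_of_pos (by positivity)]
  calc (t ^ 2 + a) * s / (C * D) * |X|
      ≤ (t ^ 2 + a) * s / (1 / 2 * (a * t)) *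
        ((27 * a ^ 6 * (t ^ 2 + a) / (t ^ 4 * (t ^ 2 + 2 * a) ^ 2)) ^ n *
          ((2 * (a * s)) * (2 * a ^ 3 / W))) := by
        refine mul_le_mul hcoef (hX2.trans ?_) (abs_nonneg _) (by positivity)
        gcongr
    _ = _ := by
        rw [hW]
        generalize (27 * a ^ 6 * (t ^ 2 + a) / (t ^ 4 * (t ^ 2 + 2 * a) ^ 2)) ^ n = Z
        rw [show 8 * a ^ 4 / (t * (t ^ 2 + a) ^ 2) = 8 * a ^ 3 * s ^ 2 / (t * (t ^ 2 + a) ^ 2) by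
          rw [hs]; ring]
        field_simp
        ring

/-- The Möbius substitution makes Qx - P an explicit multiple of the Padé remainder; S and C are the
sine and cosine of φ/3. -/
theorem root_approx_identity {a t e f s l S C : ℝ} (hs : s ^ 2 = a) (hC : C ≠ 0)
    (hd : a * t + s * l * (S / C) ≠ 0) :
    (t ^ 2 * e + a * f) * (a * (t ^ 2 + a) / (a * t + s * l * (S / C))) - t * (t ^ 2 + a) * e =
      (t ^ 2 + a) * s / (C * (a * t + s * l * (S / C))) *
        (f * (a * s) * C - e * (t * l) * S) := by
  obtain ⟨T, rfl⟩ : ∃ T, S = T * C := ⟨S / C, by field_simp⟩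
  rw [mul_div_cancel_right₀ T hC] at *
  obtain ⟨D, hD⟩ : ∃ D, D = a * t + s * l * T := ⟨_, rfl⟩
  rw [← hD] at hd ⊢
  field_simp
  linear_combination (t ^ 2 + a) * ((-t * e) * hD - a * f * hs)

theorem root_approx_error_bound {a t e f : ℝ} (n : ℕ) (ha : 0 < a) (ht : 0 < t)
    (hat : 9 * a ≤ t ^ 2)
    (hef : |f * (a * √a) * Real.cos (angle a t / 3) -
        e * (t * √(t ^ 4 + 3 * a * t ^ 2 + 3 * a ^ 2)) * Real.sin (angle a t / 3)| ≤
      3 ^ (3 * n + 1) * √((t ^ 2 + a) ^ 3) ^ (2 * n + 1) *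
        (1 / 3 * angle a t * (2 * (1 - Real.cos (angle a t))) ^ (2 * n + 1))) :
    |(t ^ 2 * e + a * f) * root a t - t * (t ^ 2 + a) * e| ≤
      8 * a ^ 4 / (t * (t ^ 2 + a) ^ 2) *
        (27 * a ^ 6 * (t ^ 2 + a) / (t ^ 4 * (t ^ 2 + 2 * a) ^ 2)) ^ n := by
  have hφ0 := angle_pos ha ht
  have hφ1 := angle_lt a t
  have hT := tan_third_pos ha ht
  have hsin := sqrt_mul_sin_angle ha ht
  have htan : angle a t * (t * √(t ^ 4 + 3 * a * t ^ 2 + 3 * a ^ 2)) ≤ a * √a := by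
    have h := Real.le_tan hφ0.le hφ1
    have h' : Real.tan (angle a t) = a * √a / (t * √(t ^ 4 + 3 * a * t ^ 2 + 3 * a ^ 2)) :=
      Real.tan_arctan _
    rwa [h', le_div_iff₀ (by positivity)] at h
  have hC : 1 / 2 ≤ Real.cos (angle a t / 3) := by
    rw [← Real.cos_pi_div_three]
    exact Real.cos_le_cos_of_nonneg_of_le_pi (by linarith) (by linarith) (by linarith)
  have hs : √a ^ 2 = a := Real.sq_sqrt ha.le
  have hs0 : 0 < √a := Real.sqrt_pos.2 ha
  have hl0 : 0 < √(t ^ 4 + 3 * a * t ^ 2 + 3 * a ^ 2) := by positivity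
  have hWsq : √((t ^ 2 + a) ^ 3) ^ 2 = (t ^ 2 + a) ^ 3 := Real.sq_sqrt (by positivity)
  have hW0 : 0 < √((t ^ 2 + a) ^ 3) := by positivity
  have hcos1 := Real.cos_le_one (angle a t)
  have hpsq := sq_add_sq_eq (t := t) ha
  have hr2 : (a * √a) ^ 2 = a ^ 3 := by rw [mul_pow, hs]; ring
  have hσ : (t ^ 2 + a) ^ 3 * Real.sin (angle a t) ^ 2 = a ^ 3 := by
    rw [← hr2, hsin, mul_pow, hWsq]
  have hδ := one_sub_bounds ha ht rfl hσ (Real.sin_sq_add_cos_sq _)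
    (Real.cos_arctan_pos _) hcos1
  have hW1000 : 1000 * a ^ 3 ≤ (t ^ 2 + a) ^ 3 := by
    calc 1000 * a ^ 3 = (9 * a + a) ^ 3 := by ring
      _ ≤ _ := by gcongr
  have hH2p : √((t ^ 2 + a) ^ 3) ≤ 2 * (t * √(t ^ 4 + 3 * a * t ^ 2 + 3 * a ^ 2)) := by
    refine le_of_sq_le_sq ?_ (by positivity)
    rw [mul_pow 2, hWsq]
    have := pow_pos ha 3
    linarith
  have hHφ : √((t ^ 2 + a) ^ 3) * angle a t ≤ 2 * (a * √a) := by nlinarith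
  have hTe := Real.tan_eq_sin_div_cos (angle a t / 3)
  rw [hTe] at hT
  have hC0 : 0 < Real.cos (angle a t / 3) := by linarith
  have hD : a * t ≤ a * t + √a * √(t ^ 4 + 3 * a * t ^ 2 + 3 * a ^ 2) *
      (Real.sin (angle a t / 3) / Real.cos (angle a t / 3)) :=
    le_add_of_nonneg_right (by positivity)
  have hD0 := (mul_pos ha ht).trans_le hD
  unfold root
  rw [hTe, root_approx_identity hs hC0.ne' hD0.ne']
  exact error_algebra n ha ht rfl hs hs0 hWsq hW0 hHφ hφ0 (by linarith) hδ.1 hδ.2 hC hD hef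

/-- Good rational approximations to the root of the cubic equation. -/
theorem exists_root_approx (a t : ℕ) (ha : 0 < a) (ht : 0 < t) (hat : 9 * a ≤ t ^ 2) :
    ∃ Q P : ℕ → ℤ,
      (∀ n, 1 ≤ n → |(Q n : ℝ)| ≤ tau3 a t * √n * c6 a t ^ n) ∧
      (∀ n, |(Q n : ℝ) * root a t - P n| ≤ tau4 a t * (c7 a t)⁻¹ ^ n) ∧
      ∀ n, Q n * P (n + 1) - Q (n + 1) * P n ≠ 0 := by
  have ha' : (0 : ℝ) < a := by exact_mod_cast ha
  have ht' : (0 : ℝ) < t := by exact_mod_cast ht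
  have hat' : 9 * (a : ℝ) ≤ (t : ℝ) ^ 2 := by exact_mod_cast hat
  have hs : √(a : ℝ) ^ 2 = a := Real.sq_sqrt ha'.le
  have hl : √((t : ℝ) ^ 4 + 3 * a * t ^ 2 + 3 * a ^ 2) ^ 2 =
    (t : ℝ) ^ 4 + 3 * a * t ^ 2 + 3 * a ^ 2 := Real.sq_sqrt (by positivity)
  have hWsq : √(((t : ℝ) ^ 2 + a) ^ 3) ^ 2 = ((t : ℝ) ^ 2 + a) ^ 3 := Real.sq_sqrt (by positivity)
  have hr2 : ((a : ℝ) * √a) ^ 2 = a ^ 3 := by rw [mul_pow, hs]; ring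
  have hpsq := sq_add_sq_eq (t := (t : ℝ)) ha'
  have hφ0 := angle_pos ha' ht'
  have hφ1 := angle_lt a t
  obtain ⟨e, f, he, hf, hef, hdet⟩ := exists_int_approx
    (P := (t : ℤ) ^ 2 * (t ^ 4 + 3 * a * t ^ 2 + 3 * a ^ 2)) (R := (a : ℤ) ^ 3)
    (by rw [mul_pow, hl]; push_cast; ring) (by rw [hr2]; push_cast; ring)
    (by positivity) (by positivity) (by positivity)
    (sqrt_mul_cos_angle ha' ht') (sqrt_mul_sin_angle ha' ht') hφ0.le
    (by linarith [Real.pi_pos])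
  refine ⟨fun n => (t : ℤ) ^ 2 * e n + a * f n, fun n => t * ((t : ℤ) ^ 2 + a) * e n,
    fun n hn => ?_, fun n => ?_, fun n => ?_⟩
  · push_cast
    have h := root_approx_denom_bound n hn ha' ht' hat' rfl (by positivity)
      (Nat.cast_pos.2 (Nat.centralBinom_pos (2 * n + 1))) hWsq
      (by rw [← hr2]; exact hpsq) (he n) (hf n) (centralBinom_sq_le (2 * n + 1))
    refine h.trans ?_
    have := le_c6 (t := (t : ℝ)) ha'
    have := (tau3_pos ha' ht').le
    gcongr
  · push_cast
    refine (root_approx_error_bound n ha' ht' hat' (hef n)).trans ?_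
    have h1 := le_inv_c7 ha' ht'
    have h2 := le_tau4 ha' ht'
    have := (tau4_pos ha' ht').le
    gcongr
  · have hne : (a : ℤ) * (t * ((t : ℤ) ^ 2 + a)) ≠ 0 := by positivity
    intro h
    refine mul_ne_zero hne (hdet n) ?_
    linear_combination -h

/-! ### From approximations to a lower bound for ‖qx‖ -/

theorem distInt_gt_of_approx {A B C D x : ℝ} {Q P : ℕ → ℤ} (hA : 0 < A) (hB : 0 < B) (hC : 1 < C)
    (hD : Real.exp 1 < D)
    (hQ : ∀ n, 1 ≤ n → |(Q n : ℝ)| ≤ A * √n * C ^ n)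
    (hR : ∀ n, |(Q n : ℝ) * x - P n| ≤ B * D⁻¹ ^ n)
    (hdet : ∀ n, Q n * P (n + 1) - Q (n + 1) * P n ≠ 0) (q : ℕ) (hq : D / (2 * B) ≤ q) :
    distInt (q * x) > Real.log D ^ (1 / 2 : ℝ) /
      (6 * A * C ^ 2 * (2 * B) ^ (Real.log C / Real.log D)) *
        (q : ℝ) ^ (-(Real.log C / Real.log D)) *
        Real.log (2 * B * q) ^ (-(Real.log C / Real.log D) - 1 / 2) := by
  have hD0 : 0 < D := (Real.exp_pos 1).trans hD
  have hC0 : 0 < C := by linarith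
  have hlogD : 1 < Real.log D := (Real.lt_log_iff_exp_lt hD0).2 hD
  have hlogC : 0 < Real.log C := Real.log_pos hC
  have hD1 : 1 < D := (Real.one_lt_exp_iff.2 one_pos).trans hD
  have hq0 : (0 : ℝ) < q := (div_pos hD0 (by positivity)).trans_le hq
  set κ : ℝ := Real.log C / Real.log D with hκ
  have hκ0 : 0 < κ := by positivity
  set X : ℝ := 2 * B * q with hX
  have hDX : D ≤ X := by
    rw [div_le_iff₀ (by positivity)] at hq
    linarith
  have hX0 : 0 < X := by positivity
  set l : ℝ := Real.log X with hl
  have hlD : Real.log D ≤ l := Real.log_le_log hD0 hDX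
  have hl1 : 1 < l := hlogD.trans_le hlD
  set ρ : ℝ := l / Real.log D with hρ
  have hρ1 : 1 ≤ ρ := by rwa [hρ, le_div_iff₀ (by linarith), one_mul]
  have hCX : C ^ ρ = X ^ κ := by
    rw [Real.rpow_def_of_pos hC0, Real.rpow_def_of_pos hX0, hρ, hκ]
    congr 1
    ring
  -- The least n with D^n > 2Bq, so that q|Q_N x - P_N| ≤ 1/2 from n on.
  obtain ⟨n, hn⟩ : ∃ n, n = ⌊ρ⌋₊ + 1 := ⟨_, rfl⟩
  have hnρ : (n : ℝ) ≤ ρ + 1 := by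
    have := Nat.floor_le (show 0 ≤ ρ by linarith)
    rw [hn]; push_cast; linarith
  have hρn : ρ < n := by
    have := Nat.lt_floor_add_one ρ
    rw [hn]; push_cast; linarith
  have hXn : X ≤ D ^ n := by
    rw [← Real.log_le_log_iff hX0 (by positivity), Real.log_pow, ← hl]
    have : l = ρ * Real.log D := by rw [hρ]; field_simp
    rw [this]
    gcongr
  have hsmall (N : ℕ) (hN : n ≤ N) : q * |(Q N : ℝ) * x - P N| ≤ 1 / 2 := by
    have h1 : X ≤ D ^ N := hXn.trans (pow_le_pow_right₀ hD1.le hN)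
    calc q * |(Q N : ℝ) * x - P N| ≤ q * (B * D⁻¹ ^ N) := by gcongr; exact hR N
      _ = X / D ^ N / 2 := by rw [hX, inv_pow]; field_simp
      _ ≤ 1 / 2 := by
        gcongr
        exact div_le_one_of_le₀ h1 (by positivity)
  obtain ⟨p, hp⟩ : ∃ p : ℤ, p = round ((q : ℝ) * x) := ⟨_, rfl⟩
  -- p/q cannot equal two consecutive, hence distinct, approximations. A nonzero integer has
  -- absolute value at least 1, of which the error term accounts for at most half.
  obtain ⟨N, hnN, hNn, hNne⟩ : ∃ N, n ≤ N ∧ N ≤ n + 1 ∧ Q N * p - P N * q ≠ 0 := by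
    by_contra! hcon
    have h1 := hcon n le_rfl (by omega)
    have h2 := hcon (n + 1) (by omega) le_rfl
    have hqz : (q : ℤ) ≠ 0 := by
      have : q ≠ 0 := by rintro rfl; simp at hq0
      exact_mod_cast this
    refine mul_ne_zero hqz (hdet n) ?_
    linear_combination (Q (n + 1)) * h1 - (Q n) * h2
  have hN1 : 1 ≤ N := by omega
  have hlow : 1 / 2 ≤ |(Q N : ℝ)| * distInt (q * x) := by
    have h1 : (1 : ℝ) ≤ |(Q N : ℝ) * p - P N * q| := by
      exact_mod_cast Int.one_le_abs hNne
    have h2 := hsmall N hnN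
    unfold distInt
    rw [← hp, ← abs_mul]
    have h3 : |(Q N : ℝ) * p - P N * q| ≤
        |(q : ℝ) * (Q N * x - P N)| + |(Q N : ℝ) * (q * x - p)| := by
      rw [← abs_neg ((Q N : ℝ) * (q * x - p))]
      refine le_trans (le_of_eq ?_) (abs_add_le _ _)
      congr 1
      ring
    rw [abs_mul, abs_of_pos hq0] at h3
    linarith
  have hNρ : (N : ℝ) ≤ ρ + 2 := by
    have : (N : ℝ) ≤ n + 1 := by exact_mod_cast hNn
    linarith
  have hQN : |(Q N : ℝ)| ≤ A * √(3 * ρ) * (C ^ 2 * X ^ κ) := by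
    refine (hQ N hN1).trans ?_
    have h1 : C ^ N ≤ C ^ 2 * X ^ κ := by
      rw [← hCX, ← Real.rpow_natCast C N, ← Real.rpow_natCast C 2, ← Real.rpow_add hC0]
      refine Real.rpow_le_rpow_of_exponent_le hC.le ?_
      push_cast
      linarith
    gcongr
    linarith
  have hdist0 : 0 ≤ distInt (q * x) := abs_nonneg _
  have hρ0 : 0 < √ρ := Real.sqrt_pos.2 (by linarith)
  have hXκ : 0 < X ^ κ := Real.rpow_pos_of_pos hX0 _
  -- N ≤ ρ + 2 ≤ 3ρ gives the factor 2√3; rounding it up to 6 makes the inequality strict.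
  have h3 : √(3 : ℝ) < 3 := by
    rw [Real.sqrt_lt' (by norm_num)]; norm_num
  have hK : 0 < A * √ρ * (C ^ 2 * X ^ κ) := by positivity
  have hlow2 : 1 < 6 * (A * √ρ * (C ^ 2 * X ^ κ)) * distInt (q * x) := by
    have h4 : |(Q N : ℝ)| ≤ √3 * (A * √ρ * (C ^ 2 * X ^ κ)) := by
      refine hQN.trans (le_of_eq ?_)
      rw [Real.sqrt_mul (by norm_num)]
      ring
    have h5 := hlow.trans (mul_le_mul_of_nonneg_right h4 hdist0)
    have h6 : 0 < distInt (q * x) := by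
      rcases hdist0.eq_or_lt with h | h
      · rw [← h, mul_zero] at h5
        norm_num at h5
      · exact h
    have h7 := mul_lt_mul_of_pos_right h3 (mul_pos hK h6)
    linarith
  have hB2 : (2 * B) ^ κ * (q : ℝ) ^ κ = X ^ κ := by
    rw [hX, Real.mul_rpow (by positivity) hq0.le]
  have hrhs : Real.log D ^ (1 / 2 : ℝ) / (6 * A * C ^ 2 * (2 * B) ^ κ) * (q : ℝ) ^ (-κ) *
      l ^ (-κ - 1 / 2) = (6 * (A * √ρ * (C ^ 2 * X ^ κ)))⁻¹ * l ^ (-κ) := by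
    have hl0 : 0 < l := by linarith
    rw [Real.rpow_neg hq0.le, sub_eq_add_neg, Real.rpow_add hl0, Real.rpow_neg hl0.le (1 / 2),
      ← Real.sqrt_eq_rpow, ← Real.sqrt_eq_rpow, ← hB2, hρ, Real.sqrt_div hl0.le]
    have : 0 < √l := Real.sqrt_pos.2 hl0
    have : 0 < √(Real.log D) := Real.sqrt_pos.2 (by linarith)
    have : 0 < (2 * B) ^ κ := by positivity
    have : 0 < (q : ℝ) ^ κ := by positivity
    field_simp
  rw [hrhs]
  -- The argument gives the logarithm with exponent -1/2 only; the additional -κ weakens the bound,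
  -- since l > 1.
  have hlκ : l ^ (-κ) ≤ 1 := Real.rpow_le_one_of_one_le_of_nonpos hl1.le (by linarith)
  calc (6 * (A * √ρ * (C ^ 2 * X ^ κ)))⁻¹ * l ^ (-κ)
      ≤ (6 * (A * √ρ * (C ^ 2 * X ^ κ)))⁻¹ * 1 := by gcongr
    _ < distInt (q * x) := by
      rw [mul_one, inv_lt_iff_one_lt_mul₀' (by positivity)]
      exact hlow2

end CubicApprox

theorem theorem1 (a t : ℕ) (ha : 0 < a) (ht : 0 < t) (hat : 9 * a ≤ t ^ 2) :
    (∃! x : ℝ, 3 * x ^ 3 - 3 * (t : ℝ) * x ^ 2 - 3 * (a : ℝ) * x + (a : ℝ) * (t : ℝ) = 0 ∧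
      (t : ℝ) / 2 < x) ∧
    ∀ x : ℝ, 3 * x ^ 3 - 3 * (t : ℝ) * x ^ 2 - 3 * (a : ℝ) * x + (a : ℝ) * (t : ℝ) = 0 →
      (t : ℝ) / 2 < x →
      Real.exp 1 < CubicApprox.c7 a t →
      (∀ q : ℕ, CubicApprox.c7 a t / (2 * CubicApprox.tau4 a t) ≤ (q : ℝ) →
        CubicApprox.distInt ((q : ℝ) * x) >
          Real.log (CubicApprox.c7 a t) ^ (1 / 2 : ℝ)
              / (6 * CubicApprox.tau3 a t * CubicApprox.c6 a t ^ 2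
                * (2 * CubicApprox.tau4 a t)
                    ^ (Real.log (CubicApprox.c6 a t) / Real.log (CubicApprox.c7 a t)))
            * (q : ℝ) ^ (-(Real.log (CubicApprox.c6 a t) / Real.log (CubicApprox.c7 a t)))
            * Real.log (2 * CubicApprox.tau4 a t * (q : ℝ))
                ^ (-(Real.log (CubicApprox.c6 a t) / Real.log (CubicApprox.c7 a t)) - 1 / 2)) ∧
      (Real.log (CubicApprox.c6 a t) / Real.log (CubicApprox.c7 a t) < 2 ↔
        CubicApprox.c6 a t < CubicApprox.c7 a t ^ 2) := by
  have ha' : (0 : ℝ) < a := by exact_mod_cast ha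
  have ht' : (0 : ℝ) < t := by exact_mod_cast ht
  have hat' : 9 * (a : ℝ) ≤ (t : ℝ) ^ 2 := by exact_mod_cast hat
  have hroot := CubicApprox.root_eq_zero ha' ht'
  have hhalf := CubicApprox.half_lt_root ha' ht'
  refine ⟨⟨CubicApprox.root a t, ⟨hroot, hhalf⟩, fun y hy =>
    CubicApprox.root_unique ha' ht' hat' hy.1 hy.2 hroot hhalf⟩, fun x hx hx2 hc7 => ?_⟩
  obtain rfl : x = CubicApprox.root a t :=
    CubicApprox.root_unique ha' ht' hat' hx hx2 hroot hhalf
  have hc6 : 1 < CubicApprox.c6 a t := by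
    refine lt_of_lt_of_le ?_ (CubicApprox.le_c6 ha')
    have h1 : (1 : ℝ) ≤ (t : ℝ) ^ 2 + a := by
      have : (1 : ℝ) ≤ a := by exact_mod_cast ha
      nlinarith
    have := one_le_pow₀ (n := 3) h1
    linarith
  obtain ⟨Q, P, hQ, hR, hdet⟩ := CubicApprox.exists_root_approx a t ha ht hat
  refine ⟨CubicApprox.distInt_gt_of_approx (CubicApprox.tau3_pos ha' ht')
    (CubicApprox.tau4_pos ha' ht') hc6 hc7 hQ hR hdet, ?_⟩
  have hc70 : 0 < CubicApprox.c7 a t := (Real.exp_pos 1).trans hc7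
  have hlog : 0 < Real.log (CubicApprox.c7 a t) :=
    one_pos.trans ((Real.lt_log_iff_exp_lt hc70).2 hc7)
  rw [div_lt_iff₀ hlog, ← Real.log_lt_log_iff (one_pos.trans hc6) (pow_pos hc70 2), Real.log_pow]
  norm_num
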